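/- There is an absolute constant $\delta>0$ with the following property. Let $G$ be a finite simple bipartite graph on $n$ vertices with maximum degree at most $3$, no connected component of which is isomorphic to the Heawood graph (the bipartite incidence graph of the points and lines of the Fano plane). Let $\lambda_1(G)\ge\lambda_2(G)\ge\cdots\ge\lambda_n(G)$ be the eigenvalues of the adjacency matrix of $G$, listed with multiplicity. Then for every integer $i$ with $1\le i\le n$ and $(\tfrac12-\delta)n\le i\le(\tfrac12+\delta)n$ we have $\lambda_i(G)\in[-1,1]$. -/

import Mathlib

/-- Incidence in the Fano plane. Points and lines are both labelled by the integers mod `7`, and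
the line `l` consists of the three points `l`, `l + 1`, `l + 3`. -/
def FanoIncident (p l : ZMod 7) : Prop :=
  p = l ∨ p = l + 1 ∨ p = l + 3

instance : DecidableRel FanoIncident := fun p l =>
  inferInstanceAs (Decidable (p = l ∨ p = l + 1 ∨ p = l + 3))

/-- Any two distinct points of the Fano plane lie on exactly one common line. -/
theorem fano_existsUnique_line :
    ∀ p q : ZMod 7, p ≠ q → ∃! l : ZMod 7, FanoIncident p l ∧ FanoIncident q l := by
  unfold ExistsUnique
  decide

/-- Any two distinct lines of the Fano plane have exactly one common point. -/
theorem fano_existsUnique_point :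
    ∀ l m : ZMod 7, l ≠ m → ∃! p : ZMod 7, FanoIncident p l ∧ FanoIncident p m := by
  unfold ExistsUnique
  decide

/-- The Heawood graph: the bipartite incidence graph of the points (left summand) and the lines
(right summand) of the Fano plane. -/
def heawoodGraph : SimpleGraph (ZMod 7 ⊕ ZMod 7) where
  Adj
    | Sum.inl p, Sum.inr l => FanoIncident p l
    | Sum.inr l, Sum.inl p => FanoIncident p l
    | _, _ => False
  symm := ⟨by
    rintro (p | l) (q | m) h
    · exact h
    · exact h
    · exact h
    · exact h⟩
  loopless := ⟨by
    rintro (p | l) h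
    · exact h
    · exact h⟩

/-- The adjacency matrix of a graph over `ℝ` is Hermitian. -/
theorem isHermitian_adjMatrix_real {V : Type*} (G : SimpleGraph V) [DecidableRel G.Adj] :
    (G.adjMatrix ℝ).IsHermitian := by
  rw [Matrix.IsHermitian, Matrix.conjTranspose_eq_transpose_of_trivial]
  exact G.isSymm_adjMatrix

/-- The eigenvalues of the adjacency matrix of a finite graph, with multiplicity and in
non-increasing order. The index is 0-based: `adjEigenvalue G i` is the eigenvalue usually
written `λ_{i+1}(G)`, where `λ_1(G) ≥ λ_2(G) ≥ ⋯ ≥ λ_n(G)`. -/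
noncomputable def adjEigenvalue {V : Type*} [Fintype V] [DecidableEq V] (G : SimpleGraph V)
    [DecidableRel G.Adj] (i : Fin (Fintype.card V)) : ℝ :=
  (isHermitian_adjMatrix_real G).eigenvalues₀ i

/-!
Let `A` be the adjacency matrix of `G`. If `A ^ 2 - 1` fails to be positive definite on each of
many balls that are far apart from each other, then `A ^ 2 ≤ 1` on a subspace of dimension `δ n`,
and together with the symmetry of the spectrum of a bipartite graph this puts the middle
eigenvalues into `[-1, 1]`.

Suppose that `A ^ 2 - 1` is positive definite on a ball. Then, inside the ball, `G` is cubic without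
4-cycles, so `A ^ 2 - 1 = 2 + A(H)` for the collinearity graph `H` (vertices at distance two in
`G`), and this is the Gram matrix of linearly independent vectors of norm `2` with inner products
`0` and `1`. If `H` contained a diamond, i.e. `K₄` without an edge, its four vectors would span a
copy of the root lattice `D₄`. The vectors adjacent to the diamond project to minimal vectors of the
dual lattice, so their residuals are unit vectors, sorted into three classes by their cosets modulo
`D₄`. Five or more such residuals cannot be linearly independent unless all lie in one class, and
counting neighbors around the diamond then gives a contradiction. With diamonds excluded,
collinearity is transitive enough to produce seven pairwise collinear vertices: the points of a
Fano plane, whose incidence graph is a component of `G`.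
-/

open Matrix

/-- `M` is positive definite on the vectors supported in `B`; equivalently, the principal submatrix
of `M` on `B` is positive definite. -/
def PosDefOn {V : Type*} [Fintype V] (M : Matrix V V ℝ) (B : Set V) : Prop :=
  ∀ x : V → ℝ, Function.support x ⊆ B → x ≠ 0 → 0 < x ⬝ᵥ M *ᵥ x

namespace PosDefOn

variable {V : Type*} [Fintype V] {M : Matrix V V ℝ} {B C : Set V}

theorem mono (h : PosDefOn M C) (hBC : B ⊆ C) : PosDefOn M B :=
  fun x hx => h x (hx.trans hBC)

theorem sum_pos (h : PosDefOn M B) {ι : Type*} [Fintype ι] (e : ι → V) (c : ι → ℝ)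
    (he : ∀ i, e i ∈ B) {i₀ : ι} (hc : c i₀ ≠ 0) (hi₀ : ∀ i, e i = e i₀ → i = i₀) :
    0 < ∑ i, ∑ j, c i * c j * M (e i) (e j) := by
  classical
  set x : V → ℝ := ∑ i, Pi.single (e i) (c i) with hx
  have hx_apply (v : V) : x v = ∑ i, if v = e i then c i else 0 := by
    simp only [hx, Finset.sum_apply, Pi.single_apply]
  have hsupp : Function.support x ⊆ B := by
    intro v hv
    rw [Function.mem_support, hx_apply] at hv
    obtain ⟨i, -, hi⟩ := Finset.exists_ne_zero_of_sum_ne_zero hv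
    obtain rfl : v = e i := by_contra fun hne => hi (if_neg hne)
    exact he i
  have hx0 : x ≠ 0 := by
    refine Function.ne_iff.mpr ⟨e i₀, ?_⟩
    rw [hx_apply, Finset.sum_eq_single_of_mem i₀ (Finset.mem_univ _)
      fun i _ hi => if_neg fun heq => hi (hi₀ i heq.symm)]
    simpa using hc
  refine (h x hsupp hx0).trans_eq ?_
  simp only [hx, sum_dotProduct, mulVec_sum, dotProduct_sum, single_dotProduct, mulVec_single,
    Pi.smul_apply, col_apply, MulOpposite.smul_eq_mul_unop, MulOpposite.unop_op]
  rw [Finset.sum_comm]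
  exact Finset.sum_congr rfl fun i _ => Finset.sum_congr rfl fun j _ => by ring

theorem diag_pos (h : PosDefOn M B) {v : V} (hv : v ∈ B) : 0 < M v v := by
  simpa using h.sum_pos (fun _ : Unit => v) (fun _ => 1) (fun _ => hv) (i₀ := ()) one_ne_zero
    fun _ _ => rfl

theorem sq_apply_lt (h : PosDefOn M B) (hM : M.IsSymm) {u v : V} (hu : u ∈ B) (hv : v ∈ B)
    (huv : u ≠ v) : M u v ^ 2 < M u u * M v v := by
  have hpos := h.diag_pos hu
  have hform := h.sum_pos ![u, v] ![-M u v, M u u] (by simp [hu, hv]) (i₀ := 1) hpos.ne'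
    (by simp [Fin.forall_fin_two, huv])
  simp only [Fin.sum_univ_two, cons_val_zero, cons_val_one, hM.apply u v] at hform
  nlinarith

/-- The Schur complement: `M - d⁻¹ • (M * F) * (M * F)ᵀ` is the Gram matrix of the projections
away from an orthogonal frame `F` of vectors of norm `d`. -/
theorem sub_frame (h : PosDefOn M B) (hM : M.IsSymm) {κ : Type*} [Fintype κ] [DecidableEq κ]
    {F : Matrix V κ ℝ} {D : Set V} (hDB : D ⊆ B) (hFD : ∀ v ∉ D, F v = 0) {d : ℝ} (hd : d ≠ 0)
    (hF : Fᵀ * M * F = d • (1 : Matrix κ κ ℝ)) :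
    PosDefOn (M - d⁻¹ • (M * F * (M * F)ᵀ)) (B \ D) := by
  intro x hx hx0
  set c : κ → ℝ := d⁻¹ • (M * F)ᵀ *ᵥ x with hc
  set y : V → ℝ := x - F *ᵥ c with hy
  have hFc (v : V) (hv : v ∉ D) : (F *ᵥ c) v = 0 := by simp [mulVec, hFD v hv]
  have hyB : Function.support y ⊆ B := by
    intro v hv
    by_contra hvB
    have hxv : x v = 0 := Function.notMem_support.mp fun hm => hvB (hx hm).1
    exact hv (by simp [hy, hxv, hFc v fun hD => hvB (hDB hD)])
  have hy0 : y ≠ 0 := by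
    obtain ⟨v, hv⟩ := Function.ne_iff.mp hx0
    refine Function.ne_iff.mpr ⟨v, ?_⟩
    simpa [hy, hFc v (hx hv).2] using hv
  have hMF : x ⬝ᵥ M *ᵥ F *ᵥ c = d * (c ⬝ᵥ c) := by
    rw [mulVec_mulVec, dotProduct_mulVec, ← mulVec_transpose, hc, smul_dotProduct, smul_eq_mul,
      ← mul_assoc, mul_inv_cancel₀ hd, one_mul]
  have hFM : (F *ᵥ c) ⬝ᵥ M *ᵥ x = d * (c ⬝ᵥ c) := by
    rw [← hMF, dotProduct_mulVec, ← mulVec_transpose, hM.eq, dotProduct_comm]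
  have hFMF : (F *ᵥ c) ⬝ᵥ M *ᵥ F *ᵥ c = d * (c ⬝ᵥ c) := by
    rw [mulVec_mulVec, ← vecMul_transpose, ← dotProduct_mulVec, mulVec_mulVec, ← Matrix.mul_assoc,
      hF, smul_mulVec, one_mulVec, dotProduct_smul, smul_eq_mul]
  have hres : x ⬝ᵥ (d⁻¹ • (M * F * (M * F)ᵀ)) *ᵥ x = d * (c ⬝ᵥ c) := by
    rw [smul_mulVec, ← mulVec_mulVec, ← mulVec_smul, ← hc, ← mulVec_mulVec, hMF]
  refine (h y hyB hy0).trans_eq ?_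
  rw [hy, mulVec_sub, sub_dotProduct, dotProduct_sub, dotProduct_sub, hMF, hFM, hFMF, sub_mulVec,
    dotProduct_sub, hres]
  ring

theorem sub_submatrix (h : PosDefOn M B) (hM : M.IsSymm) {ι κ : Type*} [Fintype ι]
    [Fintype κ] [DecidableEq κ] {e : ι → V} (he : ∀ i, e i ∈ B) {W : Matrix ι κ ℝ} {d : ℝ}
    (hd : d ≠ 0) (hW : Wᵀ * M.submatrix e e * W = d • (1 : Matrix κ κ ℝ)) :
    PosDefOn (M - d⁻¹ • (M.submatrix id e * W * (M.submatrix id e * W)ᵀ)) (B \ Set.range e) := by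
  classical
  set E : Matrix V ι ℝ := (1 : Matrix V V ℝ).submatrix id e with hE
  have hME : M * E = M.submatrix id e := by
    ext u i
    simp [hE, mul_apply, one_apply]
  have hEM (N : Matrix V ι ℝ) : Eᵀ * N = N.submatrix e id := by
    ext i j
    simp only [hE, mul_apply, transpose_apply, submatrix_apply, one_apply, id, ite_mul, one_mul,
      zero_mul, Finset.sum_ite_eq', Finset.mem_univ, if_true]
  have hFMF : (E * W)ᵀ * M * (E * W) = d • (1 : Matrix κ κ ℝ) := by
    rw [← hW, transpose_mul, Matrix.mul_assoc, Matrix.mul_assoc, ← Matrix.mul_assoc M, hME,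
      ← Matrix.mul_assoc Eᵀ, hEM, submatrix_submatrix, Matrix.mul_assoc]
    rfl
  have hzero : ∀ v ∉ Set.range e, (E * W) v = 0 := by
    intro v hv
    ext j
    have hEv (i : ι) : E v i = 0 := one_apply_ne fun hvi => hv ⟨i, hvi.symm⟩
    exact Finset.sum_eq_zero fun i _ => mul_eq_zero_of_left (hEv i) _
  have hsub := h.sub_frame hM (Set.range_subset_iff.mpr he) hzero hd hFMF
  rwa [← Matrix.mul_assoc, hME] at hsub

theorem sub_sum_mul [DecidableEq V] (h : PosDefOn M B) (hM : M.IsSymm) {S : Finset V}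
    (hSB : (S : Set V) ⊆ B) (hS : ∀ u ∈ S, ∀ v ∈ S, M u v = if u = v then 1 else 0) :
    PosDefOn (of fun u v => M u v - ∑ s ∈ S, M u s * M v s) (B \ S) := by
  have hone : (1 : Matrix S S ℝ)ᵀ * M.submatrix Subtype.val Subtype.val * 1 = (1 : ℝ) • 1 := by
    rw [transpose_one, Matrix.one_mul, Matrix.mul_one, one_smul]
    ext s t
    simp only [submatrix_apply, hS s s.2 t t.2, one_apply, Subtype.ext_iff]
  convert h.sub_submatrix hM (e := ((↑) : S → V)) (fun s => hSB s.2) one_ne_zero hone using 1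
  · ext u v
    simp [mul_apply, Finset.sum_attach S fun s => M u s * M v s]
  · simp

end PosDefOn

section Spectrum

variable {V : Type*} [Fintype V] [DecidableEq V] {A : Matrix V V ℝ}

theorem linearCombination_eigenvectors_dotProduct_sq_sub_one_mulVec (hA : A.IsHermitian)
    {κ : Type*} [Fintype κ] {f : κ → V} (hf : Function.Injective f) (c : κ → ℝ) :
    (∑ i, c i • ⇑(hA.eigenvectorBasis (f i))) ⬝ᵥ
        (A ^ 2 - 1) *ᵥ ∑ i, c i • ⇑(hA.eigenvectorBasis (f i)) =
      ∑ i, (hA.eigenvalues (f i) ^ 2 - 1) * c i ^ 2 := by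
  classical
  have horth (i j : κ) : ⇑(hA.eigenvectorBasis (f i)) ⬝ᵥ ⇑(hA.eigenvectorBasis (f j)) =
      if i = j then 1 else 0 := by
    simpa [EuclideanSpace.inner_eq_star_dotProduct, dotProduct_comm, hf.eq_iff] using
      orthonormal_iff_ite.mp hA.eigenvectorBasis.orthonormal (f i) (f j)
  have hmul (v : V) : (A ^ 2 - 1) *ᵥ ⇑(hA.eigenvectorBasis v) =
      (hA.eigenvalues v ^ 2 - 1) • ⇑(hA.eigenvectorBasis v) := by
    rw [sub_mulVec, one_mulVec, sq, ← mulVec_mulVec, hA.mulVec_eigenvectorBasis, mulVec_smul,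
      hA.mulVec_eigenvectorBasis, smul_smul, sub_smul, one_smul, sq]
  simp only [mulVec_sum, mulVec_smul, hmul, sum_dotProduct, dotProduct_sum, smul_dotProduct,
    dotProduct_smul, horth, smul_eq_mul]
  refine Finset.sum_congr rfl fun i _ => ?_
  simp only [mul_ite, mul_one, mul_zero, Finset.sum_ite_eq', Finset.mem_univ, if_true]
  ring

theorem ncard_one_lt_sq_eigenvalues_add_card_le (hA : A.IsHermitian) {ι : Type*} [Fintype ι]
    {x : ι → V → ℝ} (hx : LinearIndependent ℝ x)
    (hAx : ∀ c : ι → ℝ, (∑ k, c k • x k) ⬝ᵥ (A ^ 2 - 1) *ᵥ ∑ k, c k • x k ≤ 0) :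
    {v | 1 < hA.eigenvalues v ^ 2}.ncard + Fintype.card ι ≤ Fintype.card V := by
  classical
  set U : Set V := {v | 1 < hA.eigenvalues v ^ 2}
  set e : U → V → ℝ := fun v => ⇑(hA.eigenvectorBasis v)
  have he : LinearIndependent ℝ e :=
    (hA.eigenvectorBasis.orthonormal.linearIndependent.map'
      (WithLp.linearEquiv 2 ℝ (V → ℝ)).toLinearMap (LinearEquiv.ker _)).comp _
      Subtype.val_injective
  have hex : LinearIndependent ℝ (Sum.elim e x) := by
    refine he.sum_type hx ((Submodule.disjoint_def).mpr fun y hye hyx => ?_)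
    obtain ⟨a, rfl⟩ := (Submodule.mem_span_range_iff_exists_fun ℝ).mp hye
    obtain ⟨c, hc⟩ := (Submodule.mem_span_range_iff_exists_fun ℝ).mp hyx
    have hle := hAx c
    rw [hc, linearCombination_eigenvectors_dotProduct_sq_sub_one_mulVec hA
      Subtype.val_injective] at hle
    have hpos (v : U) : 0 < hA.eigenvalues v ^ 2 - 1 := sub_pos.mpr v.2
    have hterm (v : U) : 0 ≤ (hA.eigenvalues v ^ 2 - 1) * a v ^ 2 :=
      mul_nonneg (hpos v).le (sq_nonneg _)
    have hzero := (Fintype.sum_eq_zero_iff_of_nonneg hterm).mp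
      (hle.antisymm (Finset.sum_nonneg fun v _ => hterm v))
    refine Finset.sum_eq_zero fun v _ => ?_
    have hav : a v = 0 := by simpa [(hpos v).ne'] using congrFun hzero v
    rw [hav, zero_smul]
  simpa [Set.ncard_eq_toFinset_card'] using hex.fintype_card_le_finrank

theorem roots_charpoly_neg (hA : A.IsHermitian) :
    (-A).charpoly.roots = Finset.univ.val.map fun v => -hA.eigenvalues v := by
  have hdiag : -A = (hA.eigenvectorUnitary : Matrix V V ℝ) *
      diagonal (fun v => -hA.eigenvalues v) * (star hA.eigenvectorUnitary : Matrix V V ℝ) := by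
    conv_lhs => rw [hA.spectral_theorem, Unitary.conjStarAlgAut_apply]
    simp [← diagonal_neg]
  rw [hdiag, charpoly_mul_comm, ← Matrix.mul_assoc, Unitary.coe_star_mul_self, Matrix.one_mul,
    charpoly_diagonal, Polynomial.roots_prod _ _
      (Finset.prod_ne_zero_iff.mpr fun v _ => Polynomial.X_sub_C_ne_zero _)]
  simp only [Polynomial.roots_X_sub_C, Multiset.bind_singleton]

theorem charpoly_neg_of_sign_conj {s : V → ℝ} (hs : ∀ v, s v * s v = 1)
    (hA : diagonal s * A * diagonal s = -A) : (-A).charpoly = A.charpoly := by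
  rw [← hA, charpoly_mul_comm, ← Matrix.mul_assoc, diagonal_mul_diagonal]
  simp [hs]

theorem ncard_eigenvalues_lt_neg_eq (hA : A.IsHermitian) (hchar : (-A).charpoly = A.charpoly)
    (t : ℝ) : {v | hA.eigenvalues v < -t}.ncard = {v | t < hA.eigenvalues v}.ncard := by
  classical
  have hmap : Finset.univ.val.map (fun v => -hA.eigenvalues v) =
      Finset.univ.val.map hA.eigenvalues := by
    rw [← roots_charpoly_neg hA, hchar, hA.roots_charpoly_eq_eigenvalues]
    rfl
  have hcount := congrArg (Multiset.countP (t < ·)) hmap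
  simp only [Multiset.countP_map, lt_neg] at hcount
  rw [Set.ncard_eq_toFinset_card', Set.ncard_eq_toFinset_card', Set.toFinset_ofPred,
    Set.toFinset_ofPred]
  exact hcount

end Spectrum

/-- The vertices that can be reached from `v` by a walk of length at most `r`: the closed ball of
radius `r` in the graph metric, within the connected component of `v`. -/
def walkBall {V : Type*} (G : SimpleGraph V) (r : ℕ) (v : V) : Set V :=
  {w | ∃ p : G.Walk v w, p.length ≤ r}

namespace walkBall

variable {V : Type*} {G : SimpleGraph V} {r s : ℕ} {u v w : V}

theorem self_mem (r : ℕ) (v : V) : v ∈ walkBall G r v :=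
  ⟨.nil, Nat.zero_le r⟩

theorem mono (h : r ≤ s) (v : V) : walkBall G r v ⊆ walkBall G s v :=
  fun _ ⟨p, hp⟩ => ⟨p, hp.trans h⟩

theorem symm (h : w ∈ walkBall G r v) : v ∈ walkBall G r w :=
  let ⟨p, hp⟩ := h
  ⟨p.reverse, by rwa [SimpleGraph.Walk.length_reverse]⟩

theorem trans (h : v ∈ walkBall G r u) (h' : w ∈ walkBall G s v) : w ∈ walkBall G (r + s) u :=
  let ⟨p, hp⟩ := h
  let ⟨q, hq⟩ := h'
  ⟨p.append q, by rw [SimpleGraph.Walk.length_append]; exact add_le_add hp hq⟩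

theorem mem_of_adj (h : G.Adj v w) : w ∈ walkBall G 1 v :=
  ⟨h.toWalk, le_rfl⟩

theorem mem_of_adj_of_adj (hvu : G.Adj v u) (hwu : G.Adj w u) : w ∈ walkBall G 2 v :=
  walkBall.trans (mem_of_adj hvu) (mem_of_adj hwu.symm)

theorem subset_of_mem (h : v ∈ walkBall G s u) : walkBall G r v ⊆ walkBall G (s + r) u :=
  fun _ h' => walkBall.trans h h'

theorem zero (v : V) : walkBall G 0 v = {v} := by
  refine Set.eq_singleton_iff_unique_mem.mpr ⟨self_mem 0 v, ?_⟩
  rintro w ⟨p, hp⟩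
  exact (SimpleGraph.Walk.eq_of_length_eq_zero (Nat.le_zero.mp hp)).symm

theorem succ_subset [Fintype V] [DecidableRel G.Adj] (r : ℕ) (v : V) :
    walkBall G (r + 1) v ⊆ {v} ∪ ⋃ u ∈ G.neighborFinset v, walkBall G r u := by
  rintro w ⟨p, hp⟩
  cases p with
  | nil => exact Or.inl rfl
  | cons h q =>
    rw [SimpleGraph.Walk.length_cons, Nat.add_le_add_iff_right] at hp
    exact Or.inr (Set.mem_biUnion (by simpa using h) ⟨q, hp⟩)

variable [Fintype V] [DecidableRel G.Adj]

theorem ncard_le (hG : G.maxDegree ≤ 3) (r : ℕ) (v : V) : (walkBall G r v).ncard ≤ 4 ^ r := by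
  induction r generalizing v with
  | zero => rw [zero, Set.ncard_singleton, pow_zero]
  | succ r ih =>
    have hunion : (⋃ u ∈ G.neighborFinset v, walkBall G r u).ncard ≤ 3 * 4 ^ r := by
      refine (Finset.set_ncard_biUnion_le _ _).trans ?_
      refine (Finset.sum_le_card_nsmul _ _ _ fun u _ => ih u).trans ?_
      rw [smul_eq_mul]
      exact Nat.mul_le_mul_right _ ((G.degree_le_maxDegree v).trans hG)
    calc (walkBall G (r + 1) v).ncard
        ≤ ({v} ∪ ⋃ u ∈ G.neighborFinset v, walkBall G r u).ncard :=
          Set.ncard_le_ncard (succ_subset r v) (Set.toFinite _)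
      _ ≤ 1 + 3 * 4 ^ r := (Set.ncard_union_le _ _).trans (by simpa using hunion)
      _ ≤ 4 ^ (r + 1) := by
        have := Nat.one_le_pow r 4 (by norm_num)
        rw [pow_succ]
        omega

theorem exists_finset_pairwise_notMem (hG : G.maxDegree ≤ 3) (r : ℕ) :
    ∃ F : Finset V, (F : Set V).Pairwise (fun u v => v ∉ walkBall G r u) ∧
      Fintype.card V ≤ F.card * 4 ^ r := by
  classical
  obtain ⟨F, hF⟩ := (Set.toFinite {F : Finset V |
    (F : Set V).Pairwise fun u v => v ∉ walkBall G r u}).exists_maximal ⟨∅, by simp⟩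
  refine ⟨F, hF.prop, ?_⟩
  have hcover : (Set.univ : Set V) ⊆ ⋃ u ∈ F, walkBall G r u := by
    intro v _
    by_contra hv
    simp only [Set.mem_iUnion, not_exists] at hv
    have hins : ((insert v F : Finset V) : Set V).Pairwise fun u v => v ∉ walkBall G r u := by
      rw [Finset.coe_insert]
      exact hF.prop.insert fun u hu _ => ⟨fun h => hv u hu (walkBall.symm h), hv u hu⟩
    exact hv v (hF.le_of_ge hins (Finset.subset_insert v F) (Finset.mem_insert_self v F))
      (self_mem r v)
  calc Fintype.card V = (Set.univ : Set V).ncard := by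
        rw [Set.ncard_univ, Nat.card_eq_fintype_card]
    _ ≤ (⋃ u ∈ F, walkBall G r u).ncard := Set.ncard_le_ncard hcover (Set.toFinite _)
    _ ≤ ∑ u ∈ F, (walkBall G r u).ncard := Finset.set_ncard_biUnion_le _ _
    _ ≤ F.card * 4 ^ r :=
      (Finset.sum_le_card_nsmul _ _ _ fun u _ => ncard_le hG r u).trans_eq (smul_eq_mul _ _)

end walkBall

section Separated

variable {V ι : Type*} {x : ι → V → ℝ}

theorem linearIndependent_of_disjoint_support (hx : ∀ k, x k ≠ 0)
    (hdisj : Pairwise fun j k => Disjoint (Function.support (x j)) (Function.support (x k))) :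
    LinearIndependent ℝ x := by
  rw [linearIndependent_iff']
  intro s c hc k hk
  obtain ⟨v, hv⟩ := Function.ne_iff.mp (hx k)
  have hsum := congrFun hc v
  rw [Finset.sum_apply, Finset.sum_eq_single_of_mem k hk] at hsum
  · exact (mul_eq_zero.mp hsum).resolve_right hv
  · intro j _ hjk
    have hjv : x j v = 0 := Function.notMem_support.mp (Set.disjoint_right.mp (hdisj hjk) hv)
    rw [Pi.smul_apply, hjv, smul_zero]

theorem sum_dotProduct_mulVec_sum_nonpos [Fintype V] [Fintype ι] {M : Matrix V V ℝ}
    (hdiag : ∀ k, x k ⬝ᵥ M *ᵥ x k ≤ 0) (horth : Pairwise fun j k => x j ⬝ᵥ M *ᵥ x k = 0)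
    (c : ι → ℝ) : (∑ k, c k • x k) ⬝ᵥ M *ᵥ ∑ k, c k • x k ≤ 0 := by
  simp only [mulVec_sum, mulVec_smul, sum_dotProduct, dotProduct_sum, smul_dotProduct,
    dotProduct_smul, smul_eq_mul]
  refine Finset.sum_nonpos fun k _ => ?_
  rw [Finset.sum_eq_single_of_mem k (Finset.mem_univ k)]
  · rw [← mul_assoc]
    exact mul_nonpos_of_nonneg_of_nonpos (mul_self_nonneg _) (hdiag k)
  · intro j _ hjk
    rw [horth hjk, mul_zero]

end Separated

/-- The square of the adjacency operator of `G` exceeds the identity on the vectors supported in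
`B`, i.e. the adjacency operator strictly increases their Euclidean norm. -/
def ExpandsOn {V : Type*} [Fintype V] [DecidableEq V] (G : SimpleGraph V) [DecidableRel G.Adj]
    (B : Set V) : Prop :=
  PosDefOn (G.adjMatrix ℝ ^ 2 - 1) B

section Eigenvalues

variable {V : Type*} [Fintype V] [DecidableEq V] {G : SimpleGraph V} [DecidableRel G.Adj]

theorem adjMatrix_sq_sub_one_apply (u v : V) :
    (G.adjMatrix ℝ ^ 2 - (1 : Matrix V V ℝ)) u v =
      ((G.neighborFinset u ∩ G.neighborFinset v).card : ℝ) - if u = v then 1 else 0 := by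
  rw [Matrix.sub_apply, one_apply, sq, SimpleGraph.adjMatrix_mul_apply]
  simp only [SimpleGraph.adjMatrix_apply, Finset.sum_boole,
    SimpleGraph.adj_comm, ← SimpleGraph.mem_neighborFinset, Finset.filter_mem_eq_inter]

theorem adjMatrix_sq_sub_one_apply_eq_zero {u v : V} (huv : u ≠ v)
    (hnot : ∀ w, G.Adj u w → ¬G.Adj v w) :
    (G.adjMatrix ℝ ^ 2 - (1 : Matrix V V ℝ)) u v = 0 := by
  have hempty : G.neighborFinset u ∩ G.neighborFinset v = ∅ :=
    Finset.eq_empty_of_forall_notMem fun w hw => by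
      rw [Finset.mem_inter, SimpleGraph.mem_neighborFinset, SimpleGraph.mem_neighborFinset] at hw
      exact hnot w hw.1 hw.2
  rw [adjMatrix_sq_sub_one_apply, hempty, if_neg huv, Finset.card_empty, Nat.cast_zero, sub_zero]

theorem adjMatrix_sq_sub_one_apply_eq_zero_of_notMem {u v : V} (h : v ∉ walkBall G 2 u) :
    (G.adjMatrix ℝ ^ 2 - (1 : Matrix V V ℝ)) u v = 0 := by
  refine adjMatrix_sq_sub_one_apply_eq_zero ?_ fun w hu hv => h (walkBall.mem_of_adj_of_adj hu hv)
  rintro rfl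
  exact h (walkBall.self_mem 2 u)

theorem ncard_one_lt_sq_eigenvalues_add_card_le_of_separated {R : ℕ}
    (h : ∀ v, ¬ ExpandsOn G (walkBall G R v)) {F : Finset V}
    (hF : (F : Set V).Pairwise fun u v => v ∉ walkBall G (2 * R + 2) u) :
    {v | 1 < (isHermitian_adjMatrix_real G).eigenvalues v ^ 2}.ncard + F.card ≤
      Fintype.card V := by
  simp only [ExpandsOn, PosDefOn, not_forall, not_lt] at h
  choose x hsupp hne hle using h
  have hfar {u v : F} (huv : u ≠ v) {p q : V} (hp : x u p ≠ 0) (hq : x v q ≠ 0) :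
      q ∉ walkBall G 2 p := by
    intro hpq
    refine hF u.2 v.2 (Subtype.coe_ne_coe.mpr huv) ?_
    have := walkBall.trans (walkBall.trans (hsupp _ hp) hpq) (walkBall.symm (hsupp _ hq))
    exact walkBall.mono (by omega) _ this
  have hli : LinearIndependent ℝ fun u : F => x u :=
    linearIndependent_of_disjoint_support (fun u => hne u) fun u v huv =>
      Set.disjoint_left.mpr fun p hp hq => hfar huv hp hq (walkBall.self_mem 2 p)
  have horth : Pairwise fun u v : F => x u ⬝ᵥ (G.adjMatrix ℝ ^ 2 - 1) *ᵥ x v = 0 := by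
    intro u v huv
    refine Finset.sum_eq_zero fun p _ => mul_eq_zero.mpr (or_iff_not_imp_left.mpr fun hp => ?_)
    refine Finset.sum_eq_zero fun q _ => mul_eq_zero.mpr (or_iff_not_imp_right.mpr fun hq => ?_)
    exact adjMatrix_sq_sub_one_apply_eq_zero_of_notMem (hfar huv hp hq)
  simpa using ncard_one_lt_sq_eigenvalues_add_card_le (isHermitian_adjMatrix_real G) hli
    (sum_dotProduct_mulVec_sum_nonpos (fun u => hle u) horth)

theorem charpoly_neg_adjMatrix (hG : G.IsBipartite) :
    (-G.adjMatrix ℝ).charpoly = (G.adjMatrix ℝ).charpoly := by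
  obtain ⟨col⟩ := hG
  refine charpoly_neg_of_sign_conj (s := fun v => if col v = 0 then 1 else -1)
    (fun v => by split_ifs <;> norm_num) ?_
  ext u v
  rw [mul_diagonal, diagonal_mul, neg_apply, SimpleGraph.adjMatrix_apply]
  by_cases huv : G.Adj u v
  · have hne := col.valid huv
    rw [if_pos huv]
    split_ifs with hu hv hv
    · exact (hne (hu.trans hv.symm)).elim
    · norm_num
    · norm_num
    · omega
  · simp [huv]

theorem ncard_eigenvalues_eq_ncard_adjEigenvalue (p : ℝ → Prop) :
    {v | p ((isHermitian_adjMatrix_real G).eigenvalues v)}.ncard =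
      {i | p (adjEigenvalue G i)}.ncard :=
  Set.ncard_congr (fun v _ => (Fintype.equivOfCardEq (Fintype.card_fin _)).symm v)
    (fun _ hv => hv) (fun _ _ _ _ h => (Equiv.injective _) h) fun i hi =>
      ⟨Fintype.equivOfCardEq (Fintype.card_fin _) i, by
        simpa [Matrix.IsHermitian.eigenvalues, adjEigenvalue] using hi, by simp⟩

theorem two_mul_ncard_one_lt_adjEigenvalue_add_card_le (hG : G.IsBipartite) {R : ℕ}
    (h : ∀ v, ¬ ExpandsOn G (walkBall G R v)) {F : Finset V}
    (hF : (F : Set V).Pairwise fun u v => v ∉ walkBall G (2 * R + 2) u) :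
    2 * {i | 1 < adjEigenvalue G i}.ncard + F.card ≤ Fintype.card V ∧
      2 * {i | adjEigenvalue G i < -1}.ncard + F.card ≤ Fintype.card V := by
  have hA := isHermitian_adjMatrix_real G
  have hsq : {v | 1 < hA.eigenvalues v ^ 2} =
      {v | hA.eigenvalues v < -1} ∪ {v | 1 < hA.eigenvalues v} := by
    ext v
    rw [Set.mem_ofPred, one_lt_sq_iff_one_lt_abs, lt_abs, or_comm, lt_neg]
    rfl
  have hdisj : Disjoint {v | hA.eigenvalues v < -1} {v | 1 < hA.eigenvalues v} :=
    Set.disjoint_left.mpr fun v hv hv' => by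
      rw [Set.mem_ofPred] at hv hv'
      linarith
  have hle := ncard_one_lt_sq_eigenvalues_add_card_le_of_separated h hF
  have hsymm := ncard_eigenvalues_lt_neg_eq hA (charpoly_neg_adjMatrix hG) 1
  rw [hsq, Set.ncard_union_eq hdisj (Set.toFinite _) (Set.toFinite _), hsymm] at hle
  rw [← ncard_eigenvalues_eq_ncard_adjEigenvalue (1 < ·),
    ← ncard_eigenvalues_eq_ncard_adjEigenvalue (· < -1), hsymm, two_mul]
  exact ⟨hle, hle⟩

theorem succ_le_ncard_one_lt_adjEigenvalue {i : Fin (Fintype.card V)} (h : 1 < adjEigenvalue G i) :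
    (i : ℕ) + 1 ≤ {j | 1 < adjEigenvalue G j}.ncard := by
  have hsub : (Finset.Iic i : Set (Fin (Fintype.card V))) ⊆ {j | 1 < adjEigenvalue G j} :=
    fun j hj => h.trans_le
      ((isHermitian_adjMatrix_real G).eigenvalues₀_antitone (by simpa using hj))
  simpa only [Set.ncard_coe_finset, Fin.card_Iic] using Set.ncard_le_ncard hsub

theorem card_le_add_ncard_adjEigenvalue_lt {i : Fin (Fintype.card V)}
    (h : adjEigenvalue G i < -1) :
    Fintype.card V ≤ i + {j | adjEigenvalue G j < -1}.ncard := by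
  have hsub : (Finset.Ici i : Set (Fin (Fintype.card V))) ⊆ {j | adjEigenvalue G j < -1} :=
    fun j hj => ((isHermitian_adjMatrix_real G).eigenvalues₀_antitone
      (by simpa using hj)).trans_lt h
  have hcard := Set.ncard_le_ncard hsub
  rw [Set.ncard_coe_finset, Fin.card_Ici] at hcard
  omega

theorem adjEigenvalue_mem_Icc (hG : G.IsBipartite) (hd : G.maxDegree ≤ 3) {R : ℕ}
    (h : ∀ v, ¬ ExpandsOn G (walkBall G R v)) (i : Fin (Fintype.card V))
    (h₁ : (1 / 2 - 1 / 4 ^ (2 * R + 4)) * (Fintype.card V : ℝ) ≤ ((i : ℕ) : ℝ) + 1)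
    (h₂ : ((i : ℕ) : ℝ) + 1 ≤ (1 / 2 + 1 / 4 ^ (2 * R + 4)) * (Fintype.card V : ℝ)) :
    adjEigenvalue G i ∈ Set.Icc (-1 : ℝ) 1 := by
  obtain ⟨F, hF, hcard⟩ := walkBall.exists_finset_pairwise_notMem hd (2 * R + 2)
  obtain ⟨hgt, hlt⟩ := two_mul_ncard_one_lt_adjEigenvalue_add_card_le hG h hF
  have hF_large : 4 * (1 / 4 ^ (2 * R + 4) * (Fintype.card V : ℝ)) < F.card := by
    have hn : 0 < (Fintype.card V : ℝ) := by exact_mod_cast i.pos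
    have hcard' : (Fintype.card V : ℝ) ≤ F.card * 4 ^ (2 * R + 2) := by exact_mod_cast hcard
    rw [← mul_assoc, mul_one_div, div_mul_eq_mul_div, div_lt_iff₀ (by positivity),
      show (4 : ℝ) ^ (2 * R + 4) = 16 * 4 ^ (2 * R + 2) by ring]
    linarith
  constructor <;> by_contra! hi
  · have hle := card_le_add_ncard_adjEigenvalue_lt hi
    have hcount : (Fintype.card V : ℝ) + F.card ≤ 2 * (i : ℕ) := by exact_mod_cast (by omega)
    linarith
  · have hle := succ_le_ncard_one_lt_adjEigenvalue hi
    have hcount : 2 * (((i : ℕ) : ℝ) + 1) + F.card ≤ Fintype.card V := by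
      exact_mod_cast (by omega)
    linarith

end Eigenvalues

/-- `M` is the Gram matrix of linearly independent unit vectors, indexed by `T`, that are orthogonal
within each class of `κ` and have inner product `±1/2` across classes. -/
structure IsGluedGram {V K : Type*} [Fintype V] (M : Matrix V V ℝ) (κ : V → K)
    (T : Finset V) : Prop where
  isSymm : M.IsSymm
  posDefOn : PosDefOn M T
  apply_self : ∀ v ∈ T, M v v = 1
  apply_of_eq : ∀ u ∈ T, ∀ v ∈ T, u ≠ v → κ u = κ v → M u v = 0
  apply_of_ne : ∀ u ∈ T, ∀ v ∈ T, κ u ≠ κ v → M u v = 1 / 2 ∨ M u v = -1 / 2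

namespace IsGluedGram

variable {V K : Type*} [Fintype V] {M : Matrix V V ℝ} {κ : V → K} {T : Finset V}

theorem mul_apply_of_ne (h : IsGluedGram M κ T) {a b c : V} (ha : a ∈ T) (hb : b ∈ T) (hc : c ∈ T)
    (hba : κ b ≠ κ a) (hca : κ c ≠ κ a) : M b a * M c a = 1 / 4 ∨ M b a * M c a = -1 / 4 := by
  rcases h.apply_of_ne b hb a ha hba with hb | hb <;>
    rcases h.apply_of_ne c hc a ha hca with hc | hc <;> rw [hb, hc] <;> norm_num

theorem mul_self_apply_of_ne (h : IsGluedGram M κ T) {a b : V} (ha : a ∈ T) (hb : b ∈ T)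
    (hba : κ b ≠ κ a) : M b a * M b a = 1 / 4 :=
  (h.mul_apply_of_ne ha hb hb hba hba).resolve_right fun hneg => by
    linarith [mul_self_nonneg (M b a)]

theorem residual_self (h : IsGluedGram M κ T) {S : Finset V} {k : K} (hST : S ⊆ T)
    (hS : ∀ s ∈ S, κ s = k) {b : V} (hb : b ∈ T) (hbk : κ b ≠ k) :
    M b b - ∑ s ∈ S, M b s * M b s = 1 - S.card / 4 := by
  have hterm : ∀ s ∈ S, M b s * M b s = 1 / 4 := fun s hs =>
    h.mul_self_apply_of_ne (hST hs) hb (hS s hs ▸ hbk)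
  rw [h.apply_self b hb, Finset.sum_congr rfl hterm, Finset.sum_const, nsmul_eq_mul]
  ring

theorem residual (h : IsGluedGram M κ T) {S : Finset V} {k : K} (hST : S ⊆ T)
    (hS : ∀ s ∈ S, κ s = k) : PosDefOn (of fun u v => M u v - ∑ s ∈ S, M u s * M v s) (T \ S) := by
  classical
  refine h.posDefOn.sub_sum_mul h.isSymm (Finset.coe_subset.mpr hST) fun u hu v hv => ?_
  split_ifs with huv
  · rw [huv, h.apply_self v (hST hv)]
  · exact h.apply_of_eq u (hST hu) v (hST hv) huv ((hS u hu).trans (hS v hv).symm)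

theorem sq_residual_lt (h : IsGluedGram M κ T) {S : Finset V} {k : K} (hST : S ⊆ T)
    (hS : ∀ s ∈ S, κ s = k) {b c : V} (hb : b ∈ T) (hc : c ∈ T) (hbk : κ b ≠ k) (hck : κ c ≠ k)
    (hbc : b ≠ c) : (M b c - ∑ s ∈ S, M b s * M c s) ^ 2 < (1 - S.card / 4) ^ 2 := by
  have hmem {x : V} (hx : x ∈ T) (hxk : κ x ≠ k) : x ∈ (T \ S : Set V) :=
    ⟨hx, fun hxS => hxk (hS x hxS)⟩
  have hlt := (h.residual hST hS).sq_apply_lt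
    (by ext u v; simp only [transpose_apply, of_apply, h.isSymm.apply u v, mul_comm])
    (hmem hb hbk) (hmem hc hck) hbc
  rw [of_apply, of_apply, of_apply, h.residual_self hST hS hb hbk,
    h.residual_self hST hS hc hck, ← sq] at hlt
  exact hlt

-- Projecting away a class `{a, a'}` leaves vectors of norm `1/2`, so the residuals of `b`, `b'` and
-- `c` have to be orthogonal, which determines the signs of their inner products with `a` and `a'`.
theorem false_of_classes_two_two_one (h : IsGluedGram M κ T) {a a' b b' c : V} (ha : a ∈ T)
    (ha' : a' ∈ T) (hb : b ∈ T) (hb' : b' ∈ T) (hc : c ∈ T) (haa : a ≠ a') (hbb : b ≠ b')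
    (hκa : κ a = κ a') (hκb : κ b = κ b') (hab : κ b ≠ κ a) (hac : κ c ≠ κ a) (hbc : κ b ≠ κ c) :
    False := by
  classical
  have hST : ({a, a'} : Finset V) ⊆ T := by simp [Finset.insert_subset_iff, ha, ha']
  have hS : ∀ s ∈ ({a, a'} : Finset V), κ s = κ a := by simp [hκa]
  have hlt {x y : V} (hx : x ∈ T) (hy : y ∈ T) (hxa : κ x ≠ κ a) (hya : κ y ≠ κ a) (hxy : x ≠ y) :
      (M x y - (M x a * M y a + M x a' * M y a')) ^ 2 < (1 / 2) ^ 2 := by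
    have := h.sq_residual_lt hST hS hx hy hxa hya hxy
    rw [Finset.sum_pair haa, Finset.card_pair haa] at this
    norm_num at this ⊢
    exact this
  have hsame {x : V} (hx : x ∈ T) (hxa : κ x ≠ κ a) (hxc : κ x ≠ κ c) :
      M x a * M c a = M x a' * M c a' := by
    have hsq := hlt hx hc hxa hac (ne_of_apply_ne κ hxc)
    rcases h.apply_of_ne x hx c hc hxc with hM | hM <;>
      rcases h.mul_apply_of_ne ha hx hc hxa hac with h₁ | h₁ <;>
      rcases h.mul_apply_of_ne ha' hx hc (hκa ▸ hxa) (hκa ▸ hac) with h₂ | h₂ <;>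
      first
      | exact h₁.trans h₂.symm
      | rw [hM, h₁, h₂] at hsq; norm_num at hsq
  have hb'a : κ b' ≠ κ a := hκb ▸ hab
  have hopp := hlt hb hb' hab hb'a hbb
  have hbsame := hsame hb hab hbc
  have hb'same := hsame hb' hb'a (hκb ▸ hbc)
  have hsigns : M b a * M b' a = M b a' * M b' a' := by
    have hc₁ := h.mul_self_apply_of_ne ha hc hac
    have hc₂ := h.mul_self_apply_of_ne ha' hc (hκa ▸ hac)
    linear_combination 4 * M b' a * M c a * hbsame + 4 * M b a' * M c a' * hb'same
      - 4 * M b a * M b' a * hc₁ + 4 * M b a' * M b' a' * hc₂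
  rw [h.apply_of_eq b hb b' hb' hbb hκb, ← hsigns] at hopp
  rcases h.mul_apply_of_ne ha hb hb' hab hb'a with h₁ | h₁ <;> rw [h₁] at hopp <;>
    norm_num at hopp

variable [DecidableEq K]

theorem card_class_lt_four (h : IsGluedGram M κ T) {b : V} (hb : b ∈ T) {k : K} (hbk : κ b ≠ k) :
    (T.filter (κ · = k)).card < 4 := by
  by_contra! hcard
  obtain ⟨S, hSsub, hScard⟩ := Finset.exists_subset_card_eq hcard
  have hST : S ⊆ T := hSsub.trans (Finset.filter_subset _ _)
  have hS : ∀ s ∈ S, κ s = k := fun s hs => (Finset.mem_filter.mp (hSsub hs)).2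
  have hpos := (h.residual hST hS).diag_pos (v := b) ⟨hb, fun hbS => hbk (hS b hbS)⟩
  rw [of_apply, h.residual_self hST hS hb hbk, hScard] at hpos
  norm_num at hpos

theorem card_class_lt_three (h : IsGluedGram M κ T) {b c : V} (hb : b ∈ T) (hc : c ∈ T) {k : K}
    (hbk : κ b ≠ k) (hck : κ c ≠ k) (hbc : b ≠ c) : (T.filter (κ · = k)).card < 3 := by
  classical
  by_contra! hcard
  obtain ⟨S, hSsub, hScard⟩ := Finset.exists_subset_card_eq hcard
  have hST : S ⊆ T := hSsub.trans (Finset.filter_subset _ _)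
  have hS : ∀ s ∈ S, κ s = k := fun s hs => (Finset.mem_filter.mp (hSsub hs)).2
  have hlt := h.sq_residual_lt hST hS hb hc hbk hck hbc
  have hM : M b c = 0 ∨ M b c = 1 / 2 ∨ M b c = -1 / 2 := by
    by_cases hκ : κ b = κ c
    · exact Or.inl (h.apply_of_eq b hb c hc hbc hκ)
    · exact Or.inr (h.apply_of_ne b hb c hc hκ)
  have hprod (s : V) (hs : s ∈ S) : M b s * M c s = 1 / 4 ∨ M b s * M c s = -1 / 4 :=
    h.mul_apply_of_ne (hST hs) hb hc (hS s hs ▸ hbk) (hS s hs ▸ hck)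
  obtain ⟨s, t, u, hst, hsu, htu, rfl⟩ := Finset.card_eq_three.mp hScard
  rw [hScard, Finset.sum_insert (by simp [hst, hsu]), Finset.sum_pair htu] at hlt
  rcases hM with hM | hM | hM <;> rcases hprod s (by simp) with hs | hs <;>
    rcases hprod t (by simp) with ht | ht <;> rcases hprod u (by simp) with hu | hu <;>
    rw [hM, hs, ht, hu] at hlt <;> norm_num at hlt

theorem apply_eq_of_five_le_card {κ : V → Fin 3} (h : IsGluedGram M κ T) (hT : 5 ≤ T.card) {u v : V}
    (hu : u ∈ T) (hv : v ∈ T) : κ u = κ v := by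
  by_contra huv
  set n : Fin 3 → ℕ := fun k => (T.filter (κ · = k)).card with hn
  have hsum : T.card = n 0 + n 1 + n 2 := by
    rw [Finset.card_eq_sum_card_fiberwise (f := κ) (t := Finset.univ) fun _ _ => Finset.mem_univ _,
      Fin.sum_univ_three]
  have hle_two (k : Fin 3) : n k ≤ 2 := by
    by_contra! hk
    have hcompl := Finset.card_filter_add_card_filter_not (s := T) (κ · = k)
    have hone : (T.filter (¬ κ · = k)).card ≤ 1 := by
      refine Finset.card_le_one.mpr fun b hb c hc => by_contra fun hbc => ?_
      rw [Finset.mem_filter] at hb hc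
      exact (h.card_class_lt_three hb.1 hc.1 hb.2 hc.2 hbc).not_ge hk
    have hfour : n k < 4 := by
      by_cases huk : κ u = k
      · exact h.card_class_lt_four hv (huk ▸ Ne.symm huv)
      · exact h.card_class_lt_four hu huk
    simp only [hn] at hk hfour
    omega
  have hnot (i j k : Fin 3) (hij : i ≠ j) (hik : i ≠ k) (hjk : j ≠ k) (hi : 2 ≤ n i)
      (hj : 2 ≤ n j) (hk : 1 ≤ n k) : False := by
    obtain ⟨a, ha, a', ha', haa⟩ := Finset.one_lt_card.mp hi
    obtain ⟨b, hb, b', hb', hbb⟩ := Finset.one_lt_card.mp hj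
    obtain ⟨c, hc⟩ := Finset.card_pos.mp hk
    simp only [Finset.mem_filter] at ha ha' hb hb' hc
    refine h.false_of_classes_two_two_one ha.1 ha'.1 hb.1 hb'.1 hc.1 haa hbb ?_ ?_ ?_ ?_ ?_ <;>
      simp [ha.2, ha'.2, hb.2, hb'.2, hc.2, hij.symm, hik.symm, hjk]
  have h0 := hle_two 0
  have h1 := hle_two 1
  have h2 := hle_two 2
  rcases (by omega : n 0 = 2 ∧ n 1 = 2 ∧ 1 ≤ n 2 ∨ n 0 = 2 ∧ n 2 = 2 ∧ 1 ≤ n 1 ∨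
    n 1 = 2 ∧ n 2 = 2 ∧ 1 ≤ n 0) with ⟨hi, hj, hk⟩ | ⟨hi, hj, hk⟩ | ⟨hi, hj, hk⟩ <;>
    exact hnot _ _ _ (by decide) (by decide) (by decide) hi.ge hj.ge hk

end IsGluedGram

section Trace

/-- The Gram matrix `2 • 1 + A` of the diamond graph `K₄ - e`, whose poles come first; it spans a
root lattice of type `D₄`. -/
def diamondGram : Matrix (Fin 4) (Fin 4) ℤ :=
  !![2, 0, 1, 1; 0, 2, 1, 1; 1, 1, 2, 1; 1, 1, 1, 2]

/-- The columns `p`, `q`, `z - w` and `z + w - p - q` are pairwise orthogonal roots of the lattice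
with Gram matrix `diamondGram`. -/
def rootFrame : Matrix (Fin 4) (Fin 4) ℤ :=
  !![1, 0, 0, -1; 0, 1, 0, -1; 0, 0, 1, 1; 0, 0, -1, 1]

theorem rootFrame_transpose_mul_diamondGram_mul :
    rootFrameᵀ * diamondGram * rootFrame = diagonal fun _ => 2 := by
  decide

/-- The inner products with `rootFrame` of a vector whose inner products with the four vertices of
the diamond are given by `t`. -/
def frameCoord (t : Fin 4 → Bool) : Fin 4 → ℤ :=
  (fun i => if t i then 1 else 0) ᵥ* rootFrame

/-- The coset, in the discriminant group `D₄* / D₄`, of the projection to the span of the diamond;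
meaningful for the vectors that project to minimal vectors of `D₄*`. -/
def glueClass (t : Fin 4 → Bool) : Fin 3 :=
  if t 0 = t 1 then 0 else if xor (t 0) (xor (t 2) (t 3)) then 1 else 2

theorem frameCoord_dotProduct_self : ∀ t : Fin 4 → Bool, (∃ i, t i) →
    frameCoord t ⬝ᵥ frameCoord t < 4 → frameCoord t ⬝ᵥ frameCoord t = 2 := by
  decide +kernel

theorem even_frameCoord_dotProduct_iff : ∀ s t : Fin 4 → Bool, (∃ i, s i) → (∃ i, t i) →
    frameCoord s ⬝ᵥ frameCoord s < 4 → frameCoord t ⬝ᵥ frameCoord t < 4 →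
    (Even (frameCoord s ⬝ᵥ frameCoord t) ↔ glueClass s = glueClass t) := by
  decide +kernel

end Trace

/-- On the index set `B`, the matrix `M` is the positive definite matrix `2 • 1 + A`, where `A` is
the adjacency matrix of `H`: the Gram matrix of a basis of roots of norm `2`. -/
structure IsRootGram {V : Type*} [Fintype V] (M : Matrix V V ℝ) (H : SimpleGraph V)
    (B : Set V) : Prop where
  isSymm : M.IsSymm
  posDefOn : PosDefOn M B
  apply_self : ∀ v ∈ B, M v v = 2
  apply_of_adj : ∀ u ∈ B, ∀ v ∈ B, H.Adj u v → M u v = 1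
  apply_of_not_adj : ∀ u ∈ B, ∀ v ∈ B, u ≠ v → ¬H.Adj u v → M u v = 0

/-- An induced copy of `K₄ - e` in `H`: the poles `p` and `q` are the ends of the missing edge, and
`z` and `w` are the rim. -/
structure IsDiamond {V : Type*} (H : SimpleGraph V) (p q z w : V) : Prop where
  ne : p ≠ q
  not_adj : ¬H.Adj p q
  adj_zw : H.Adj z w
  adj_pz : H.Adj p z
  adj_pw : H.Adj p w
  adj_qz : H.Adj q z
  adj_qw : H.Adj q w

namespace IsDiamond

variable {V : Type*} {H : SimpleGraph V} {p q z w : V}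

theorem swap_poles (h : IsDiamond H p q z w) : IsDiamond H q p z w :=
  ⟨h.ne.symm, fun hqp => h.not_adj hqp.symm, h.adj_zw, h.adj_qz, h.adj_qw, h.adj_pz, h.adj_pw⟩

end IsDiamond

/-- The Gram matrix of the projections away from the span of the diamond with vertices `d`. -/
noncomputable def diamondResidual {V : Type*} (M : Matrix V V ℝ) (d : Fin 4 → V) :
    Matrix V V ℝ :=
  M - (2 : ℝ)⁻¹ • (M.submatrix id d * rootFrame.map (Int.cast : ℤ → ℝ) *
    (M.submatrix id d * rootFrame.map (Int.cast : ℤ → ℝ))ᵀ)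

theorem isSymm_diamondResidual {V : Type*} {M : Matrix V V ℝ} (hM : M.IsSymm)
    (d : Fin 4 → V) : (diamondResidual M d).IsSymm := by
  rw [IsSymm, diamondResidual, transpose_sub, transpose_smul, transpose_mul, transpose_transpose,
    hM.eq]

/-- Which of the vertices `d` the vertex `y` is adjacent to. -/
def adjTrace {V : Type*} (H : SimpleGraph V) [DecidableRel H.Adj] (d : Fin 4 → V) (y : V) :
    Fin 4 → Bool :=
  fun i => decide (H.Adj y (d i))

namespace IsRootGram

variable {V : Type*} [Fintype V] {M : Matrix V V ℝ} {H : SimpleGraph V} {B : Set V} {p q z w : V}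

theorem adj_of_not_adj (h : IsRootGram M H B) (hp : p ∈ B) (hq : q ∈ B) (hz : z ∈ B) (hw : w ∈ B)
    (hpq : p ≠ q) (hzw : z ≠ w) (hpz : H.Adj p z) (hpw : H.Adj p w) (hqz : H.Adj q z)
    (hqw : H.Adj q w) (hnot : ¬H.Adj p q) : H.Adj z w := by
  by_contra hzw'
  have hpos := h.posDefOn.sum_pos ![p, q, z, w] ![1, 1, -1, -1]
    (by simp [Fin.forall_fin_succ, hp, hq, hz, hw]) (i₀ := 0) (by simp)
    (by simp [Fin.forall_fin_succ, hpq.symm, hpz.ne', hpw.ne'])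
  simp only [Fin.sum_univ_four, cons_val_zero, cons_val_one, cons_val, h.apply_self _ hp,
    h.apply_self _ hq, h.apply_self _ hz, h.apply_self _ hw, h.apply_of_adj p hp z hz hpz,
    h.apply_of_adj p hp w hw hpw, h.apply_of_adj q hq z hz hqz, h.apply_of_adj q hq w hw hqw,
    h.apply_of_adj z hz p hp hpz.symm, h.apply_of_adj w hw p hp hpw.symm,
    h.apply_of_adj z hz q hq hqz.symm, h.apply_of_adj w hw q hq hqw.symm,
    h.apply_of_not_adj p hp q hq hpq hnot, h.apply_of_not_adj z hz w hw hzw hzw',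
    h.apply_of_not_adj q hq p hp hpq.symm fun hqp => hnot hqp.symm,
    h.apply_of_not_adj w hw z hz hzw.symm fun hwz => hzw' hwz.symm] at hpos
  norm_num at hpos

theorem submatrix_diamond (h : IsRootGram M H B) (hD : IsDiamond H p q z w)
    (hDB : Set.range ![p, q, z, w] ⊆ B) :
    M.submatrix ![p, q, z, w] ![p, q, z, w] = diamondGram.map (Int.cast : ℤ → ℝ) := by
  have hp : p ∈ B := hDB ⟨0, rfl⟩
  have hq : q ∈ B := hDB ⟨1, rfl⟩
  have hz : z ∈ B := hDB ⟨2, rfl⟩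
  have hw : w ∈ B := hDB ⟨3, rfl⟩
  have hadj {u v : V} (hu : u ∈ B) (hv : v ∈ B) (huv : H.Adj u v) : M u v = 1 ∧ M v u = 1 :=
    ⟨h.apply_of_adj u hu v hv huv, h.apply_of_adj v hv u hu huv.symm⟩
  have hpq := h.apply_of_not_adj p hp q hq hD.ne hD.not_adj
  ext i j
  fin_cases i <;> fin_cases j <;>
    simp [diamondGram, h.apply_self _ hp, h.apply_self _ hq, h.apply_self _ hz, h.apply_self _ hw,
      hpq, h.isSymm.apply p q, hadj hp hz hD.adj_pz, hadj hp hw hD.adj_pw, hadj hq hz hD.adj_qz,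
      hadj hq hw hD.adj_qw, hadj hz hw hD.adj_zw]

theorem posDefOn_diamondResidual (h : IsRootGram M H B)
    (hD : IsDiamond H p q z w) (hDB : Set.range ![p, q, z, w] ⊆ B) :
    PosDefOn (diamondResidual M ![p, q, z, w]) (B \ Set.range ![p, q, z, w]) := by
  refine h.posDefOn.sub_submatrix h.isSymm (Set.range_subset_iff.mp hDB) two_ne_zero ?_
  have hmap := congrArg (fun N : Matrix (Fin 4) (Fin 4) ℤ => N.map (Int.cast : ℤ → ℝ))
    rootFrame_transpose_mul_diamondGram_mul
  simp only [Matrix.map_mul_intCast] at hmap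
  rw [h.submatrix_diamond hD hDB, ← transpose_map, hmap, diagonal_map Int.cast_zero,
    smul_one_eq_diagonal]
  norm_num

variable [DecidableRel H.Adj]

theorem apply_eq_ite_adj (h : IsRootGram M H B) {u v : V} (hu : u ∈ B) (hv : v ∈ B) (huv : u ≠ v) :
    M u v = ((if H.Adj u v then 1 else 0 : ℤ) : ℝ) := by
  split_ifs with hadj
  · simpa using h.apply_of_adj u hu v hv hadj
  · simpa using h.apply_of_not_adj u hu v hv huv hadj

theorem diamondResidual_apply (h : IsRootGram M H B) {d : Fin 4 → V} (hd : Set.range d ⊆ B)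
    {u v : V} (hu : u ∈ B \ Set.range d) (hv : v ∈ B \ Set.range d) :
    diamondResidual M d u v =
      M u v - ((frameCoord (adjTrace H d u) ⬝ᵥ frameCoord (adjTrace H d v) : ℤ) : ℝ) / 2 := by
  have hentry {y : V} (hy : y ∈ B \ Set.range d) (i : Fin 4) :
      M y (d i) = ((if adjTrace H d y i then 1 else 0 : ℤ) : ℝ) := by
    simp only [h.apply_eq_ite_adj hy.1 (hd ⟨i, rfl⟩) fun heq => hy.2 ⟨i, heq.symm⟩, adjTrace,
      decide_eq_true_eq]
  have hcoord {y : V} (hy : y ∈ B \ Set.range d) (j : Fin 4) :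
      (M.submatrix id d * rootFrame.map (Int.cast : ℤ → ℝ)) y j =
        frameCoord (adjTrace H d y) j := by
    simp only [mul_apply, submatrix_apply, id, hentry hy, map_apply, frameCoord, vecMul, dotProduct]
    push_cast
    rfl
  rw [diamondResidual, Matrix.sub_apply, Matrix.smul_apply, mul_apply]
  simp only [transpose_apply, hcoord hu, hcoord hv, dotProduct]
  push_cast
  rw [smul_eq_mul]
  ring

theorem frameCoord_dotProduct_self_lt_four (h : IsRootGram M H B) (hD : IsDiamond H p q z w)
    (hDB : Set.range ![p, q, z, w] ⊆ B) {y : V} (hy : y ∈ B \ Set.range ![p, q, z, w]) :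
    frameCoord (adjTrace H ![p, q, z, w] y) ⬝ᵥ frameCoord (adjTrace H ![p, q, z, w] y) < 4 := by
  have hpos := (h.posDefOn_diamondResidual hD hDB).diag_pos hy
  rw [h.diamondResidual_apply hDB hy hy, h.apply_self y hy.1] at hpos
  have hlt : ((frameCoord (adjTrace H ![p, q, z, w] y) ⬝ᵥ
    frameCoord (adjTrace H ![p, q, z, w] y) : ℤ) : ℝ) < 4 := by linarith
  exact_mod_cast hlt

theorem diamondResidual_apply_self (h : IsRootGram M H B) (hD : IsDiamond H p q z w)
    (hDB : Set.range ![p, q, z, w] ⊆ B) {y : V} (hy : y ∈ B \ Set.range ![p, q, z, w])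
    (hty : ∃ i, adjTrace H ![p, q, z, w] y i) : diamondResidual M ![p, q, z, w] y y = 1 := by
  rw [h.diamondResidual_apply hDB hy hy, h.apply_self y hy.1,
    frameCoord_dotProduct_self _ hty (h.frameCoord_dotProduct_self_lt_four hD hDB hy)]
  norm_num

theorem abs_two_mul_adj_sub_lt (h : IsRootGram M H B) (hD : IsDiamond H p q z w)
    (hDB : Set.range ![p, q, z, w] ⊆ B) {u v : V} (hu : u ∈ B \ Set.range ![p, q, z, w])
    (hv : v ∈ B \ Set.range ![p, q, z, w]) (htu : ∃ i, adjTrace H ![p, q, z, w] u i)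
    (htv : ∃ i, adjTrace H ![p, q, z, w] v i) (huv : u ≠ v) :
    |2 * (if H.Adj u v then 1 else 0) - frameCoord (adjTrace H ![p, q, z, w] u) ⬝ᵥ
      frameCoord (adjTrace H ![p, q, z, w] v)| < 2 := by
  have hlt := (h.posDefOn_diamondResidual hD hDB).sq_apply_lt (isSymm_diamondResidual h.isSymm _)
    hu hv huv
  rw [h.diamondResidual_apply_self hD hDB hu htu, h.diamondResidual_apply_self hD hDB hv htv,
    h.diamondResidual_apply hDB hu hv, h.apply_eq_ite_adj hu.1 hv.1 huv, mul_one,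
    sq_lt_one_iff_abs_lt_one, abs_lt] at hlt
  rw [← Int.cast_lt (R := ℝ), Int.cast_abs, abs_lt]
  push_cast at hlt ⊢
  constructor <;> linarith

theorem exists_diamondResidual_apply_eq (h : IsRootGram M H B) (hD : IsDiamond H p q z w)
    (hDB : Set.range ![p, q, z, w] ⊆ B) {u v : V} (hu : u ∈ B \ Set.range ![p, q, z, w])
    (hv : v ∈ B \ Set.range ![p, q, z, w]) (htu : ∃ i, adjTrace H ![p, q, z, w] u i)
    (htv : ∃ i, adjTrace H ![p, q, z, w] v i) (huv : u ≠ v) :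
    ∃ n : ℤ, |n| < 2 ∧ diamondResidual M ![p, q, z, w] u v = n / 2 ∧
      (Even n ↔
        glueClass (adjTrace H ![p, q, z, w] u) = glueClass (adjTrace H ![p, q, z, w] v)) := by
  refine ⟨_, h.abs_two_mul_adj_sub_lt hD hDB hu hv htu htv huv, ?_, ?_⟩
  · rw [h.diamondResidual_apply hDB hu hv, h.apply_eq_ite_adj hu.1 hv.1 huv]
    push_cast
    ring
  · rw [← even_frameCoord_dotProduct_iff _ _ htu htv
      (h.frameCoord_dotProduct_self_lt_four hD hDB hu)
      (h.frameCoord_dotProduct_self_lt_four hD hDB hv), Int.even_sub]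
    simp only [even_two_mul, true_iff]

theorem isGluedGram_diamondResidual (h : IsRootGram M H B) (hD : IsDiamond H p q z w)
    (hDB : Set.range ![p, q, z, w] ⊆ B) {T : Finset V} (hT : ∀ y ∈ T,
      y ∈ B \ Set.range ![p, q, z, w] ∧ ∃ i, adjTrace H ![p, q, z, w] y i) :
    IsGluedGram (diamondResidual M ![p, q, z, w])
      (fun y => glueClass (adjTrace H ![p, q, z, w] y)) T where
  isSymm := isSymm_diamondResidual h.isSymm _
  posDefOn := (h.posDefOn_diamondResidual hD hDB).mono fun y hy => (hT y hy).1
  apply_self y hy := h.diamondResidual_apply_self hD hDB (hT y hy).1 (hT y hy).2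
  apply_of_eq u hu v hv huv hκ := by
    obtain ⟨n, hn, happly, heven⟩ :=
      h.exists_diamondResidual_apply_eq hD hDB (hT u hu).1 (hT v hv).1 (hT u hu).2 (hT v hv).2 huv
    obtain ⟨k, rfl⟩ := heven.mpr hκ
    obtain rfl : k = 0 := by rw [abs_lt] at hn; omega
    simpa using happly
  apply_of_ne u hu v hv hκ := by
    obtain ⟨n, hn, happly, heven⟩ :=
      h.exists_diamondResidual_apply_eq hD hDB (hT u hu).1 (hT v hv).1 (hT u hu).2 (hT v hv).2
        fun huv => hκ (by rw [huv])
    obtain ⟨k, rfl⟩ := Int.not_even_iff_odd.mp (heven.not.mpr hκ)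
    obtain rfl | rfl : k = 0 ∨ k = -1 := by rw [abs_lt] at hn; omega
    · exact Or.inl (by rw [happly]; norm_num)
    · exact Or.inr (by rw [happly]; norm_num)

end IsRootGram

/-- `v` has six neighbors in `H`, all of them in `B`, and they are partitioned into three pairs of
adjacent vertices by the involution `σ`; this is how three lines of size three through `v` look in
a collinearity graph. -/
structure IsInteriorPoint {V : Type*} [Fintype V] (H : SimpleGraph V) [DecidableRel H.Adj]
    (B : Set V) (v : V) : Prop where
  mem : v ∈ B
  neighborSet_subset : H.neighborSet v ⊆ B
  degree_eq : H.degree v = 6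
  exists_pairing : ∃ σ : V → V, ∀ y, H.Adj v y → H.Adj v (σ y) ∧ H.Adj y (σ y) ∧ σ (σ y) = y

/-- Every vertex attached to the diamond `p, q, z, w` is adjacent to exactly one of the poles, and
it is adjacent to `p` if and only if it does not distinguish `z` from `w`. -/
def IsPolarized {V : Type*} (H : SimpleGraph V) (p q z w : V) : Prop :=
  ∀ y, y ≠ p → y ≠ q → y ≠ z → y ≠ w → H.Adj y p ∨ H.Adj y q ∨ H.Adj y z ∨ H.Adj y w →
    (H.Adj y q ↔ ¬H.Adj y p) ∧ (H.Adj y p ↔ (H.Adj y z ↔ H.Adj y w))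

section Diamond

variable {V : Type*} {H : SimpleGraph V} {p q z w : V}

theorem IsDiamond.swap_rim (hD : IsDiamond H p q z w) : IsDiamond H p q w z :=
  ⟨hD.ne, hD.not_adj, hD.adj_zw.symm, hD.adj_pw, hD.adj_pz, hD.adj_qw, hD.adj_qz⟩

namespace IsPolarized

theorem swap_rim (hpol : IsPolarized H p q z w) : IsPolarized H p q w z := by
  intro y hyp hyq hyw hyz hadj
  rw [iff_comm (a := H.Adj y w)]
  exact hpol y hyp hyq hyz hyw (by tauto)

variable [Fintype V] [DecidableEq V] [DecidableRel H.Adj]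

theorem degree_rim (hpol : IsPolarized H p q z w) (hD : IsDiamond H p q z w) :
    H.degree z = 3 + (H.neighborFinset p ∩ H.neighborFinset z ∩ H.neighborFinset w).card +
      ((H.neighborFinset q ∩ H.neighborFinset z) \ insert w (H.neighborFinset w)).card := by
  obtain ⟨hne, hpq, hzw, hpz, hpw, hqz, hqw⟩ := hD
  have hN : H.neighborFinset z =
      {p, q, w} ∪ H.neighborFinset p ∩ H.neighborFinset z ∩ H.neighborFinset w ∪
        (H.neighborFinset q ∩ H.neighborFinset z) \ insert w (H.neighborFinset w) := by
    ext y
    have := hpol y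
    simp only [SimpleGraph.mem_neighborFinset, Finset.mem_union, Finset.mem_insert,
      Finset.mem_singleton, Finset.mem_inter, Finset.mem_sdiff]
    grind [SimpleGraph.adj_comm, SimpleGraph.irrefl]
  rw [← SimpleGraph.card_neighborFinset_eq_degree, congrArg Finset.card hN,
    Finset.card_union_of_disjoint, Finset.card_union_of_disjoint,
    Finset.card_eq_three.mpr ⟨p, q, w, hne, hpw.ne, hqw.ne, rfl⟩]
  all_goals
    simp only [Finset.disjoint_left, SimpleGraph.mem_neighborFinset, Finset.mem_union,
      Finset.mem_insert, Finset.mem_singleton, Finset.mem_inter, Finset.mem_sdiff]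
    grind [SimpleGraph.adj_comm, SimpleGraph.irrefl]

theorem degree_pole (hpol : IsPolarized H p q z w) (hD : IsDiamond H p q z w) :
    H.degree q =
      2 + ((H.neighborFinset q ∩ H.neighborFinset z) \ insert w (H.neighborFinset w)).card +
        ((H.neighborFinset q ∩ H.neighborFinset w) \ insert z (H.neighborFinset z)).card := by
  obtain ⟨_, hpq, hzw, _, _, hqz, hqw⟩ := hD
  have hN : H.neighborFinset q =
      {z, w} ∪ (H.neighborFinset q ∩ H.neighborFinset z) \ insert w (H.neighborFinset w) ∪
        (H.neighborFinset q ∩ H.neighborFinset w) \ insert z (H.neighborFinset z) := by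
    ext y
    have := hpol y
    have hyq : H.Adj q y → y ≠ q := SimpleGraph.Adj.ne'
    simp only [SimpleGraph.mem_neighborFinset, Finset.mem_union, Finset.mem_insert,
      Finset.mem_singleton, Finset.mem_inter, Finset.mem_sdiff]
    grind [SimpleGraph.adj_comm]
  rw [← SimpleGraph.card_neighborFinset_eq_degree, congrArg Finset.card hN,
    Finset.card_union_of_disjoint, Finset.card_union_of_disjoint, Finset.card_pair hzw.ne]
  all_goals
    simp only [Finset.disjoint_left, SimpleGraph.mem_neighborFinset, Finset.mem_union,
      Finset.mem_insert, Finset.mem_singleton, Finset.mem_inter, Finset.mem_sdiff]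
    grind [SimpleGraph.irrefl]

theorem card_common_neighbors (hpol : IsPolarized H p q z w)
    (hD : IsDiamond H p q z w) (hq : H.degree q = 6) (hz : H.degree z = 6) (hw : H.degree w = 6) :
    (H.neighborFinset p ∩ H.neighborFinset z ∩ H.neighborFinset w).card = 1 := by
  have hdz := hpol.degree_rim hD
  have hdw := hpol.swap_rim.degree_rim hD.swap_rim
  have hdq := hpol.degree_pole hD
  rw [Finset.inter_right_comm] at hdw
  omega

end IsPolarized

end Diamond

section Trace

theorem glueClass_eq_zero_iff : ∀ t : Fin 4 → Bool, glueClass t = 0 ↔ t 0 = t 1 := by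
  decide

theorem glueClass_eq_one_iff : ∀ t : Fin 4 → Bool, glueClass t = 1 ↔
    (t 1 ↔ ¬t 0) ∧ (t 0 ↔ (t 2 ↔ t 3)) := by
  decide

theorem glueClass_eq_two_iff : ∀ t : Fin 4 → Bool, glueClass t = 2 ↔
    (t 0 ↔ ¬t 1) ∧ (t 1 ↔ (t 2 ↔ t 3)) := by
  decide

end Trace

namespace IsRootGram

variable {V : Type*} [Fintype V] {M : Matrix V V ℝ} {H : SimpleGraph V} {B : Set V}
  {p q z w : V} [DecidableRel H.Adj]

theorem card_neighborFinset_inter_le [DecidableEq V] (h : IsRootGram M H B)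
    (hD : IsDiamond H p q z w) (hp : IsInteriorPoint H B p) (hq : IsInteriorPoint H B q)
    (hz : IsInteriorPoint H B z) :
    (H.neighborFinset p ∩ H.neighborFinset q).card ≤ 5 := by
  have hsub : H.neighborFinset p ∩ H.neighborFinset q ⊆ insert z (H.neighborFinset z \ {p, q}) := by
    intro y hy
    simp only [Finset.mem_inter, SimpleGraph.mem_neighborFinset] at hy
    simp only [Finset.mem_insert, Finset.mem_sdiff, SimpleGraph.mem_neighborFinset,
      Finset.mem_singleton, not_or]
    refine or_iff_not_imp_left.mpr fun hyz => ⟨?_, hy.1.ne', hy.2.ne'⟩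
    exact h.adj_of_not_adj hp.mem hq.mem hz.mem (hp.neighborSet_subset hy.1) hD.ne (Ne.symm hyz)
      hD.adj_pz hy.1 hD.adj_qz hy.2 hD.not_adj
  have hpq : ({p, q} : Finset V) ⊆ H.neighborFinset z := by
    simp [Finset.insert_subset_iff, hD.adj_pz.symm, hD.adj_qz.symm]
  calc _ ≤ (H.neighborFinset z \ {p, q}).card + 1 :=
        (Finset.card_le_card hsub).trans (Finset.card_insert_le _ _)
    _ = 5 := by
      rw [Finset.card_sdiff_of_subset hpq, SimpleGraph.card_neighborFinset_eq_degree,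
        hz.degree_eq, Finset.card_pair hD.ne]

theorem glueClass_adjTrace_eq (h : IsRootGram M H B) (hD : IsDiamond H p q z w)
    (hI : ∀ y ∈ Set.range ![p, q, z, w], IsInteriorPoint H B y) {u v : V}
    (hu : u ∉ Set.range ![p, q, z, w]) (hv : v ∉ Set.range ![p, q, z, w])
    (htu : ∃ i, H.Adj u (![p, q, z, w] i)) (htv : ∃ i, H.Adj v (![p, q, z, w] i)) :
    glueClass (adjTrace H ![p, q, z, w] u) = glueClass (adjTrace H ![p, q, z, w] v) := by
  classical
  let T : Finset V := {y | y ∉ Set.range ![p, q, z, w] ∧ ∃ i, H.Adj y (![p, q, z, w] i)}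
  have hT : ∀ y ∈ T, y ∈ B \ Set.range ![p, q, z, w] ∧ ∃ i, adjTrace H ![p, q, z, w] y i := by
    intro y hy
    obtain ⟨hy, i, hi⟩ := (Finset.mem_filter_univ y).mp hy
    exact ⟨⟨(hI _ ⟨i, rfl⟩).neighborSet_subset hi.symm, hy⟩, i, by simpa [adjTrace] using hi⟩
  have hsub : (H.neighborFinset p ∪ H.neighborFinset q) \ {z, w} ⊆ T := by
    intro y hy
    simp only [Finset.mem_sdiff, Finset.mem_union, SimpleGraph.mem_neighborFinset,
      Finset.mem_insert, Finset.mem_singleton, not_or] at hy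
    have hyp : p ≠ y := by rintro rfl; exact hy.1.elim H.irrefl fun hqp => hD.not_adj hqp.symm
    have hyq : q ≠ y := by rintro rfl; exact hy.1.elim hD.not_adj H.irrefl
    refine (Finset.mem_filter_univ y).mpr ⟨?_, ?_⟩
    · simpa [hyp.symm, hyq.symm, and_comm] using hy.2
    · exact hy.1.elim (fun hpy => ⟨0, hpy.symm⟩) fun hqy => ⟨1, hqy.symm⟩
  have hT_card : 5 ≤ T.card := by
    have hinter := h.card_neighborFinset_inter_le hD (hI _ ⟨0, rfl⟩) (hI _ ⟨1, rfl⟩) (hI _ ⟨2, rfl⟩)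
    have hunion := Finset.card_union_add_card_inter (H.neighborFinset p) (H.neighborFinset q)
    rw [SimpleGraph.card_neighborFinset_eq_degree, SimpleGraph.card_neighborFinset_eq_degree,
      (hI p ⟨0, rfl⟩).degree_eq, (hI q ⟨1, rfl⟩).degree_eq] at hunion
    have hsdiff := Finset.le_card_sdiff {z, w} (H.neighborFinset p ∪ H.neighborFinset q)
    rw [Finset.card_pair hD.adj_zw.ne] at hsdiff
    have := Finset.card_le_card hsub
    omega
  exact (h.isGluedGram_diamondResidual hD (fun y hy => (hI y hy).mem) hT).apply_eq_of_five_le_card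
    hT_card ((Finset.mem_filter_univ u).mpr ⟨hu, htu⟩) ((Finset.mem_filter_univ v).mpr ⟨hv, htv⟩)

theorem isPolarized_or_isPolarized (h : IsRootGram M H B) (hD : IsDiamond H p q z w)
    (hI : ∀ y ∈ Set.range ![p, q, z, w], IsInteriorPoint H B y) :
    IsPolarized H p q z w ∨ IsPolarized H q p z w := by
  classical
  obtain ⟨u, hpu, hqu⟩ : ∃ u, H.Adj p u ∧ ¬H.Adj q u := by
    by_contra! hall
    have hinter := h.card_neighborFinset_inter_le hD (hI _ ⟨0, rfl⟩) (hI _ ⟨1, rfl⟩) (hI _ ⟨2, rfl⟩)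
    rw [Finset.inter_eq_left.mpr fun y => by simpa using hall y,
      SimpleGraph.card_neighborFinset_eq_degree, (hI p ⟨0, rfl⟩).degree_eq] at hinter
    omega
  have hu : u ∉ Set.range ![p, q, z, w] := by
    rintro ⟨i, rfl⟩
    fin_cases i
    exacts [H.irrefl hpu, hD.not_adj hpu, hqu hD.adj_qz, hqu hD.adj_qw]
  have hclass (y : V) (hyp : y ≠ p) (hyq : y ≠ q) (hyz : y ≠ z) (hyw : y ≠ w)
      (hy : H.Adj y p ∨ H.Adj y q ∨ H.Adj y z ∨ H.Adj y w) :
      glueClass (adjTrace H ![p, q, z, w] y) = glueClass (adjTrace H ![p, q, z, w] u) :=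
    h.glueClass_adjTrace_eq hD hI (by simp [hyp, hyq, hyz, hyw]) hu
      (by simpa [Fin.exists_fin_succ] using hy) ⟨0, hpu.symm⟩
  obtain hzero | hone | htwo : glueClass (adjTrace H ![p, q, z, w] u) = 0 ∨
      glueClass (adjTrace H ![p, q, z, w] u) = 1 ∨
      glueClass (adjTrace H ![p, q, z, w] u) = 2 := by omega
  · rw [glueClass_eq_zero_iff] at hzero
    simp [adjTrace, hpu.symm, mt SimpleGraph.Adj.symm hqu] at hzero
  · refine Or.inl fun y hyp hyq hyz hyw hy => ?_
    have hy_one := (hclass y hyp hyq hyz hyw hy).trans hone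
    rw [glueClass_eq_one_iff] at hy_one
    simp only [adjTrace, decide_eq_true_eq] at hy_one
    exact hy_one
  · refine Or.inr fun y hyq hyp hyz hyw hy => ?_
    have hy_two := (hclass y hyp hyq hyz hyw (by tauto)).trans htwo
    rw [glueClass_eq_two_iff] at hy_two
    simp only [adjTrace, decide_eq_true_eq] at hy_two
    exact hy_two

theorem not_adj_of_isPolarized (h : IsRootGram M H B) (hD : IsDiamond H p q z w)
    (hpol : IsPolarized H p q z w) (hp : IsInteriorPoint H B p)
    (hDB : Set.range ![p, q, z, w] ⊆ B) {s v : V} (hps : H.Adj p s) (hzs : H.Adj z s)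
    (hws : H.Adj w s) (hpv : H.Adj p v) (hzv : ¬H.Adj z v) (hwv : ¬H.Adj w v) : ¬H.Adj s v := by
  intro hsv
  have hpole {y : V} (hpy : H.Adj p y) (hyz : y ≠ z) (hyw : y ≠ w) :
      y ∉ Set.range ![p, q, z, w] ∧ ¬H.Adj y q := by
    have hyq : y ≠ q := by rintro rfl; exact hD.not_adj hpy
    refine ⟨by simp [hpy.ne', hyq, hyz, hyw], fun h => ?_⟩
    exact (hpol y hpy.ne' hyq hyz hyw (Or.inl hpy.symm)).1.mp h hpy.symm
  obtain ⟨hs, hsq⟩ := hpole hps hzs.ne' hws.ne'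
  obtain ⟨hv, hvq⟩ := hpole hpv (by rintro rfl; exact hwv hD.adj_zw.symm)
    (by rintro rfl; exact hzv hD.adj_zw)
  have hts : adjTrace H ![p, q, z, w] s = ![true, false, true, true] := by
    ext i
    fin_cases i <;> simp [adjTrace, hps.symm, hsq, hzs.symm, hws.symm]
  have htv : adjTrace H ![p, q, z, w] v = ![true, false, false, false] := by
    ext i
    fin_cases i <;>
      simp [adjTrace, hpv.symm, hvq, mt SimpleGraph.Adj.symm hzv, mt SimpleGraph.Adj.symm hwv]
  have hlt := h.abs_two_mul_adj_sub_lt hD hDB ⟨hp.neighborSet_subset hps, hs⟩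
    ⟨hp.neighborSet_subset hpv, hv⟩ ⟨0, by simp [hts]⟩ ⟨0, by simp [htv]⟩ hsv.ne
  rw [hts, htv, if_pos hsv] at hlt
  revert hlt
  decide

theorem not_isPolarized (h : IsRootGram M H B) (hD : IsDiamond H p q z w)
    (hI : ∀ y ∈ Set.range ![p, q, z, w], IsInteriorPoint H B y) : ¬IsPolarized H p q z w := by
  classical
  intro hpol
  obtain ⟨s, hs⟩ := Finset.card_eq_one.mp (hpol.card_common_neighbors hD (hI q ⟨1, rfl⟩).degree_eq
    (hI z ⟨2, rfl⟩).degree_eq (hI w ⟨3, rfl⟩).degree_eq)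
  have hmem (y : V) : H.Adj p y ∧ H.Adj z y ∧ H.Adj w y ↔ y = s := by
    simpa using Finset.ext_iff.mp hs y
  obtain ⟨hps, hzs, hws⟩ := (hmem s).mpr rfl
  have hsame {y : V} (hpy : H.Adj p y) (hyz : y ≠ z) (hyw : y ≠ w) : H.Adj z y ↔ H.Adj w y := by
    have hyq : y ≠ q := by rintro rfl; exact hD.not_adj hpy
    simpa only [H.adj_comm y, hpy, true_iff] using
      (hpol y hpy.ne' hyq hyz hyw (Or.inl hpy.symm)).2
  obtain ⟨σ, hσ⟩ := (hI p ⟨0, rfl⟩).exists_pairing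
  obtain ⟨hpv, hsv, hσs⟩ := hσ s hps
  have hσs_mem : σ s = z ∨ σ s = w := by
    by_contra! hne
    have hnot : ¬(H.Adj z (σ s) ∧ H.Adj w (σ s)) := fun hadj =>
      hsv.ne' ((hmem _).mp ⟨hpv, hadj.1, hadj.2⟩)
    rw [hsame hpv hne.1 hne.2, and_self] at hnot
    exact h.not_adj_of_isPolarized hD hpol (hI p ⟨0, rfl⟩) (fun y hy => (hI y hy).mem) hps hzs hws
      hpv (mt (hsame hpv hne.1 hne.2).mp hnot) hnot hsv
  obtain ⟨hpz', hzz', hσz⟩ := hσ z hD.adj_pz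
  obtain ⟨hpw', hww', hσw⟩ := hσ w hD.adj_pw
  obtain hz | hw := hσs_mem
  · have hne : σ w ≠ z := fun hwz => hws.ne (by rw [← hσw, hwz, ← hz, hσs])
    have hσw_eq : σ w = s :=
      (hmem _).mp ⟨hpw', (hsame hpw' hne hww'.ne').mpr hww', hww'⟩
    exact hD.adj_zw.ne (by rw [← hz, ← hσw_eq, hσw])
  · have hne : σ z ≠ w := fun hzw => hzs.ne (by rw [← hσz, hzw, ← hw, hσs])
    have hσz_eq : σ z = s :=
      (hmem _).mp ⟨hpz', hzz', (hsame hpz' hzz'.ne' hne).mp hzz'⟩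
    exact hD.adj_zw.ne (by rw [← hw, ← hσz_eq, hσz])

theorem not_isDiamond (h : IsRootGram M H B)
    (hI : ∀ y ∈ Set.range ![p, q, z, w], IsInteriorPoint H B y) : ¬IsDiamond H p q z w := by
  intro hD
  obtain hpol | hpol := h.isPolarized_or_isPolarized hD hI
  · exact h.not_isPolarized hD hI hpol
  · refine h.not_isPolarized hD.swap_poles (fun y ⟨i, hi⟩ => hI y ?_) hpol
    subst hi
    fin_cases i
    exacts [⟨1, rfl⟩, ⟨0, rfl⟩, ⟨2, rfl⟩, ⟨3, rfl⟩]

end IsRootGram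

section Expansion

variable {V : Type*} {G : SimpleGraph V} {B : Set V}

theorem walkBall.subset_of_adj {r : ℕ} {u v : V} (h : walkBall G (r + 1) u ⊆ B)
    (huv : G.Adj u v) : walkBall G r v ⊆ B := by
  rw [add_comm] at h
  exact (walkBall.subset_of_mem (walkBall.mem_of_adj huv)).trans h

theorem walkBall.subset_of_adj_of_adj {r : ℕ} {u v ℓ : V} (h : walkBall G (r + 2) u ⊆ B)
    (hu : G.Adj u ℓ) (hv : G.Adj v ℓ) : walkBall G r v ⊆ B :=
  walkBall.subset_of_adj (walkBall.subset_of_adj h hu) hv.symm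

variable [Fintype V] [DecidableEq V] [DecidableRel G.Adj]

theorem adjMatrix_sq_sub_one_apply_self (v : V) :
    (G.adjMatrix ℝ ^ 2 - (1 : Matrix V V ℝ)) v v = G.degree v - 1 := by
  rw [adjMatrix_sq_sub_one_apply, if_pos rfl, Finset.inter_self,
    SimpleGraph.card_neighborFinset_eq_degree]

theorem isSymm_adjMatrix_sq_sub_one : (G.adjMatrix ℝ ^ 2 - (1 : Matrix V V ℝ)).IsSymm :=
  (G.isSymm_adjMatrix.pow 2).sub isSymm_one

namespace ExpandsOn

variable {p u v x y ℓ ℓ' : V}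

theorem two_le_degree (h : ExpandsOn G B) (hv : v ∈ B) : 2 ≤ G.degree v := by
  have hpos := PosDefOn.diag_pos h hv
  rw [adjMatrix_sq_sub_one_apply_self, sub_pos] at hpos
  exact_mod_cast hpos

theorem sq_card_inter_lt (h : ExpandsOn G B) (hu : u ∈ B) (hv : v ∈ B) (huv : u ≠ v) :
    (G.neighborFinset u ∩ G.neighborFinset v).card ^ 2 <
      (G.degree u - 1) * (G.degree v - 1) := by
  have hlt := PosDefOn.sq_apply_lt h isSymm_adjMatrix_sq_sub_one hu hv huv
  rw [adjMatrix_sq_sub_one_apply_self, adjMatrix_sq_sub_one_apply_self,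
    adjMatrix_sq_sub_one_apply, if_neg huv, sub_zero] at hlt
  have hdu := h.two_le_degree hu
  have hdv := h.two_le_degree hv
  rw [← Nat.cast_lt (α := ℝ)]
  push_cast [Nat.cast_sub (by omega : 1 ≤ G.degree u), Nat.cast_sub (by omega : 1 ≤ G.degree v)]
  exact hlt

theorem card_inter_le_one (h : ExpandsOn G B) (hd : G.maxDegree ≤ 3) (hu : u ∈ B) (hv : v ∈ B)
    (huv : u ≠ v) : (G.neighborFinset u ∩ G.neighborFinset v).card ≤ 1 := by
  have hdu := (G.degree_le_maxDegree u).trans hd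
  have hdv := (G.degree_le_maxDegree v).trans hd
  have hlt : (G.neighborFinset u ∩ G.neighborFinset v).card ^ 2 < 2 * 2 :=
    (h.sq_card_inter_lt hu hv huv).trans_le (Nat.mul_le_mul (by omega) (by omega))
  nlinarith

theorem eq_of_common_neighbors (h : ExpandsOn G B) (hd : G.maxDegree ≤ 3) (hu : u ∈ B)
    (hv : v ∈ B) (huv : u ≠ v) (huℓ : G.Adj u ℓ) (hvℓ : G.Adj v ℓ) (huℓ' : G.Adj u ℓ')
    (hvℓ' : G.Adj v ℓ') : ℓ = ℓ' :=
  Finset.card_le_one.mp (h.card_inter_le_one hd hu hv huv) ℓ (by simp [huℓ, hvℓ]) ℓ'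
    (by simp [huℓ', hvℓ'])

theorem apply_eq_one (h : ExpandsOn G B) (hd : G.maxDegree ≤ 3) (hu : u ∈ B) (hv : v ∈ B)
    (huv : u ≠ v) (huℓ : G.Adj u ℓ) (hvℓ : G.Adj v ℓ) :
    (G.adjMatrix ℝ ^ 2 - (1 : Matrix V V ℝ)) u v = 1 := by
  have hpos : 0 < (G.neighborFinset u ∩ G.neighborFinset v).card :=
    Finset.card_pos.mpr ⟨ℓ, by simp [huℓ, hvℓ]⟩
  have hone := le_antisymm (h.card_inter_le_one hd hu hv huv) hpos
  rw [adjMatrix_sq_sub_one_apply, hone, if_neg huv, Nat.cast_one, sub_zero]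

theorem false_of_degree_two_of_degree_two (h : ExpandsOn G B) (hu : u ∈ B) (hv : v ∈ B)
    (huv : u ≠ v) (hdu : G.degree u = 2) (hdv : G.degree v = 2) (huℓ : G.Adj u ℓ)
    (hvℓ : G.Adj v ℓ) : False := by
  have hlt := h.sq_card_inter_lt hu hv huv
  have hpos : 0 < (G.neighborFinset u ∩ G.neighborFinset v).card :=
    Finset.card_pos.mpr ⟨ℓ, by simp [huℓ, hvℓ]⟩
  rw [hdu, hdv] at hlt
  nlinarith

end ExpandsOn

end Expansion

section Degree

variable {V : Type*} [Fintype V] [DecidableEq V] {G : SimpleGraph V} [DecidableRel G.Adj]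
  {B : Set V} {p x y ℓ₁ ℓ₂ : V}

namespace ExpandsOn

theorem exists_adj_adj_of_degree_two (h : ExpandsOn G B) (hd : G.maxDegree ≤ 3) (hp : p ∈ B)
    (hx : x ∈ B) (hy : y ∈ B) (hdp : G.degree p = 2) (hpx : p ≠ x) (hpy : p ≠ y) (hxy : x ≠ y)
    (hp₁ : G.Adj p ℓ₁) (hx₁ : G.Adj x ℓ₁) (hp₂ : G.Adj p ℓ₂) (hy₂ : G.Adj y ℓ₂) :
    ∃ m, G.Adj x m ∧ G.Adj y m := by
  by_contra! hnot
  have hform := PosDefOn.sum_pos h ![p, x, y] ![2, -1, -1]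
    (by simp [Fin.forall_fin_succ, hp, hx, hy]) (i₀ := 0) (by simp)
    (by simp [Fin.forall_fin_succ, hpx.symm, hpy.symm])
  have hdx : (G.degree x : ℝ) ≤ 3 := by exact_mod_cast (G.degree_le_maxDegree x).trans hd
  have hdy : (G.degree y : ℝ) ≤ 3 := by exact_mod_cast (G.degree_le_maxDegree y).trans hd
  simp only [Fin.sum_univ_three, cons_val_zero, cons_val_one, cons_val,
    adjMatrix_sq_sub_one_apply_self, hdp, h.apply_eq_one hd hp hx hpx hp₁ hx₁,
    h.apply_eq_one hd hx hp hpx.symm hx₁ hp₁, h.apply_eq_one hd hp hy hpy hp₂ hy₂,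
    h.apply_eq_one hd hy hp hpy.symm hy₂ hp₂, adjMatrix_sq_sub_one_apply_eq_zero hxy hnot,
    adjMatrix_sq_sub_one_apply_eq_zero hxy.symm fun m hym hxm => hnot m hxm hym] at hform
  push_cast at hform
  linarith

theorem exists_adj_of_degree_two_of_adj (h : ExpandsOn G B) (hd : G.maxDegree ≤ 3) {u m : V}
    (hp : p ∈ B) (hx : x ∈ B) (hy : y ∈ B) (hu : u ∈ B) (hdp : G.degree p = 2) (hpx : p ≠ x)
    (hpy : p ≠ y) (hpu : p ≠ u) (hxy : x ≠ y) (hxu : x ≠ u) (hyu : y ≠ u)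
    (hp₁ : G.Adj p ℓ₁) (hx₁ : G.Adj x ℓ₁) (hp₂ : G.Adj p ℓ₂) (hy₂ : G.Adj y ℓ₂)
    (hxm : G.Adj x m) (hym : G.Adj y m) (hum : G.Adj u m) :
    ∃ m, G.Adj p m ∧ G.Adj u m := by
  by_contra! hnot
  have hform := PosDefOn.sum_pos h ![p, u, x, y] ![2, 1, -1, -1]
    (by simp [Fin.forall_fin_succ, hp, hx, hy, hu]) (i₀ := 0) (by simp)
    (by simp [Fin.forall_fin_succ, hpx.symm, hpy.symm, hpu.symm])
  have hdx : (G.degree x : ℝ) ≤ 3 := by exact_mod_cast (G.degree_le_maxDegree x).trans hd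
  have hdy : (G.degree y : ℝ) ≤ 3 := by exact_mod_cast (G.degree_le_maxDegree y).trans hd
  have hdu : (G.degree u : ℝ) ≤ 3 := by exact_mod_cast (G.degree_le_maxDegree u).trans hd
  simp only [Fin.sum_univ_four, cons_val_zero, cons_val_one, cons_val,
    adjMatrix_sq_sub_one_apply_self, hdp, h.apply_eq_one hd hp hx hpx hp₁ hx₁,
    h.apply_eq_one hd hx hp hpx.symm hx₁ hp₁, h.apply_eq_one hd hp hy hpy hp₂ hy₂,
    h.apply_eq_one hd hy hp hpy.symm hy₂ hp₂, h.apply_eq_one hd hx hy hxy hxm hym,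
    h.apply_eq_one hd hy hx hxy.symm hym hxm, h.apply_eq_one hd hx hu hxu hxm hum,
    h.apply_eq_one hd hu hx hxu.symm hum hxm, h.apply_eq_one hd hy hu hyu hym hum,
    h.apply_eq_one hd hu hy hyu.symm hum hym, adjMatrix_sq_sub_one_apply_eq_zero hpu hnot,
    adjMatrix_sq_sub_one_apply_eq_zero hpu.symm fun m hum hpm => hnot m hpm hum] at hform
  push_cast at hform
  linarith

theorem exists_neighborFinset_eq_pair (h : ExpandsOn G B) (hd : G.maxDegree ≤ 3)
    (hp : walkBall G 4 p ⊆ B) (hdp : G.neighborFinset p = {ℓ₁, ℓ₂}) (hℓ : ℓ₁ ≠ ℓ₂)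
    (hpx : p ≠ x) (hpy : p ≠ y) (hx₁ : G.Adj x ℓ₁) (hy₂ : G.Adj y ℓ₂) :
    x ≠ y ∧ ∃ m, G.neighborFinset m = {x, y} := by
  have hp₁ : G.Adj p ℓ₁ := by simp [← SimpleGraph.mem_neighborFinset, hdp]
  have hp₂ : G.Adj p ℓ₂ := by simp [← SimpleGraph.mem_neighborFinset, hdp]
  have hdeg : G.degree p = 2 := by
    rw [← SimpleGraph.card_neighborFinset_eq_degree, hdp, Finset.card_pair hℓ]
  have hpB : p ∈ B := hp (walkBall.self_mem _ _)
  have hx_ball : walkBall G 2 x ⊆ B := walkBall.subset_of_adj_of_adj hp hp₁ hx₁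
  have hxB : x ∈ B := hx_ball (walkBall.self_mem _ _)
  have hyB : y ∈ B := walkBall.subset_of_adj_of_adj hp hp₂ hy₂ (walkBall.self_mem _ _)
  have hxy : x ≠ y := by
    rintro rfl
    exact hℓ (h.eq_of_common_neighbors hd hpB hxB hpx hp₁ hx₁ hp₂ hy₂)
  obtain ⟨m, hxm, hym⟩ :=
    h.exists_adj_adj_of_degree_two hd hpB hxB hyB hdeg hpx hpy hxy hp₁ hx₁ hp₂ hy₂
  have hm₁ : ℓ₁ ≠ m := by
    rintro rfl
    exact hℓ (h.eq_of_common_neighbors hd hpB hyB hpy hp₁ hym hp₂ hy₂)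
  have hm₂ : ℓ₂ ≠ m := by
    rintro rfl
    exact hℓ (h.eq_of_common_neighbors hd hpB hxB hpx hp₁ hx₁ hp₂ hxm)
  refine ⟨hxy, m, Finset.Subset.antisymm (fun u hu => ?_) (by
    simp [Finset.insert_subset_iff, hxm.symm, hym.symm])⟩
  by_contra hne
  simp only [SimpleGraph.mem_neighborFinset, Finset.mem_insert, Finset.mem_singleton,
    not_or] at hu hne
  have huB : u ∈ B := hx_ball (walkBall.mem_of_adj_of_adj hxm hu.symm)
  have hpm : ¬G.Adj p m := by simp [← SimpleGraph.mem_neighborFinset, hdp, hm₁.symm, hm₂.symm]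
  have hpu : p ≠ u := by rintro rfl; exact hpm hu.symm
  obtain ⟨ℓ, hpℓ, huℓ⟩ := h.exists_adj_of_degree_two_of_adj hd hpB hxB hyB huB hdeg hpx hpy hpu hxy
    (Ne.symm hne.1) (Ne.symm hne.2) hp₁ hx₁ hp₂ hy₂ hxm hym hu.symm
  rw [← SimpleGraph.mem_neighborFinset, hdp, Finset.mem_insert, Finset.mem_singleton] at hpℓ
  obtain rfl | rfl := hpℓ
  · exact hm₁ (h.eq_of_common_neighbors hd hxB huB (Ne.symm hne.1) hx₁ huℓ hxm hu.symm)
  · exact hm₂ (h.eq_of_common_neighbors hd hyB huB (Ne.symm hne.2) hy₂ huℓ hym hu.symm)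

theorem degree_eq_two_of_neighborFinset_eq_pair (h : ExpandsOn G B) (hd : G.maxDegree ≤ 3)
    (hp : walkBall G 4 p ⊆ B) (hdp : G.neighborFinset p = {ℓ₁, ℓ₂}) (hℓ : ℓ₁ ≠ ℓ₂) :
    G.degree ℓ₁ = 2 := by
  have hp₁ : G.Adj p ℓ₁ := by simp [← SimpleGraph.mem_neighborFinset, hdp]
  have hp₂ : G.Adj p ℓ₂ := by simp [← SimpleGraph.mem_neighborFinset, hdp]
  have hℓ₁ : ℓ₁ ∈ B := walkBall.subset_of_adj hp hp₁ (walkBall.self_mem _ _)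
  have hℓ₂ : ℓ₂ ∈ B := walkBall.subset_of_adj hp hp₂ (walkBall.self_mem _ _)
  refine le_antisymm (not_lt.mp fun hthree => ?_) (h.two_le_degree hℓ₁)
  obtain ⟨y, hy, hyp⟩ := Finset.exists_mem_ne (h.two_le_degree hℓ₂) p
  rw [SimpleGraph.mem_neighborFinset, SimpleGraph.adj_comm] at hy
  have herase : 1 < ((G.neighborFinset ℓ₁).erase p).card := by
    rw [Finset.card_erase_of_mem (by simpa using hp₁.symm),
      SimpleGraph.card_neighborFinset_eq_degree]
    omega
  obtain ⟨x, hx, x', hx', hxx'⟩ := Finset.one_lt_card.mp herase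
  simp only [Finset.mem_erase, SimpleGraph.mem_neighborFinset, G.adj_comm ℓ₁] at hx hx'
  obtain ⟨hxy, m, hm⟩ := h.exists_neighborFinset_eq_pair hd hp hdp hℓ hx.1.symm hyp.symm hx.2 hy
  obtain ⟨hx'y, m', hm'⟩ :=
    h.exists_neighborFinset_eq_pair hd hp hdp hℓ hx'.1.symm hyp.symm hx'.2 hy
  have hym : G.Adj m y := by simp [← SimpleGraph.mem_neighborFinset, hm]
  have hym' : G.Adj m' y := by simp [← SimpleGraph.mem_neighborFinset, hm']
  have hy_ball : walkBall G 2 y ⊆ B := walkBall.subset_of_adj_of_adj hp hp₂ hy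
  have hmem {n : V} (hn : G.Adj n y) : n ∈ B :=
    walkBall.subset_of_adj hy_ball hn.symm (walkBall.self_mem _ _)
  have hmm' : m ≠ m' := by
    rintro rfl
    have hxm : x ∈ G.neighborFinset m := by simp [hm]
    simp [hm', hxx', hxy] at hxm
  refine h.false_of_degree_two_of_degree_two (hmem hym) (hmem hym') hmm' ?_ ?_ hym hym'
  · rw [← SimpleGraph.card_neighborFinset_eq_degree, hm, Finset.card_pair hxy]
  · rw [← SimpleGraph.card_neighborFinset_eq_degree, hm', Finset.card_pair hx'y]

theorem degree_eq_three (h : ExpandsOn G B) (hd : G.maxDegree ≤ 3) (hp : walkBall G 4 p ⊆ B) :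
    G.degree p = 3 := by
  refine le_antisymm ((G.degree_le_maxDegree p).trans hd) (not_lt.mp fun hlt => ?_)
  have htwo := h.two_le_degree (hp (walkBall.self_mem _ _))
  obtain ⟨ℓ₁, ℓ₂, hℓ, hdp⟩ := Finset.card_eq_two.mp (le_antisymm (Nat.lt_succ_iff.mp hlt) htwo)
  have hp₁ : G.Adj p ℓ₁ := by simp [← SimpleGraph.mem_neighborFinset, hdp]
  have hp₂ : G.Adj p ℓ₂ := by simp [← SimpleGraph.mem_neighborFinset, hdp]
  exact h.false_of_degree_two_of_degree_two
    (walkBall.subset_of_adj hp hp₁ (walkBall.self_mem _ _))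
    (walkBall.subset_of_adj hp hp₂ (walkBall.self_mem _ _)) hℓ
    (h.degree_eq_two_of_neighborFinset_eq_pair hd hp hdp hℓ)
    (h.degree_eq_two_of_neighborFinset_eq_pair hd hp (hdp.trans (Finset.pair_comm _ _)) hℓ.symm)
    hp₁.symm hp₂.symm

end ExpandsOn

end Degree

/-- The graph joining two vertices of `G` with a common neighbor. For bipartite `G`, regarded as
the incidence graph of points and lines, it joins two points on a common line and dually two lines
through a common point. -/
def collinearityGraph {V : Type*} (G : SimpleGraph V) : SimpleGraph V where
  Adj p q := p ≠ q ∧ ∃ ℓ, G.Adj p ℓ ∧ G.Adj q ℓ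
  symm := ⟨fun _ _ ⟨hne, ℓ, hp, hq⟩ => ⟨hne.symm, ℓ, hq, hp⟩⟩
  loopless := ⟨fun _ h => h.1 rfl⟩

instance {V : Type*} [Fintype V] [DecidableEq V] (G : SimpleGraph V) [DecidableRel G.Adj] :
    DecidableRel (collinearityGraph G).Adj :=
  fun p q => inferInstanceAs (Decidable (p ≠ q ∧ ∃ ℓ, G.Adj p ℓ ∧ G.Adj q ℓ))

theorem exists_neighborFinset_eq_triple {V : Type*} [DecidableEq V] {G : SimpleGraph V}
    {u v ℓ : V} [Fintype (G.neighborSet ℓ)] (hℓ : G.degree ℓ = 3) (hu : G.Adj u ℓ)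
    (hv : G.Adj v ℓ) (huv : u ≠ v) :
    ∃ w, w ≠ u ∧ w ≠ v ∧ G.neighborFinset ℓ = {u, v, w} := by
  have hsub : {u, v} ⊆ G.neighborFinset ℓ := by
    simp [Finset.insert_subset_iff, hu.symm, hv.symm]
  have hcard : (G.neighborFinset ℓ \ {u, v}).card = 1 := by
    rw [Finset.card_sdiff_of_subset hsub, Finset.card_pair huv,
      SimpleGraph.card_neighborFinset_eq_degree, hℓ]
  obtain ⟨w, hw⟩ := Finset.card_eq_one.mp hcard
  have hmem : w ∈ G.neighborFinset ℓ \ {u, v} := by simp [hw]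
  simp only [Finset.mem_sdiff, Finset.mem_insert, Finset.mem_singleton, not_or] at hmem
  refine ⟨w, hmem.2.1, hmem.2.2, ?_⟩
  rw [← Finset.union_sdiff_of_subset hsub, hw, Finset.insert_union, Finset.singleton_union]

section Collinearity

variable {V : Type*} [Fintype V] [DecidableEq V] {G : SimpleGraph V} [DecidableRel G.Adj]
  {B : Set V} {v : V}

theorem neighborFinset_collinearityGraph (v : V) :
    (collinearityGraph G).neighborFinset v =
      (G.neighborFinset v).biUnion fun ℓ => (G.neighborFinset ℓ).erase v := by
  ext w
  rw [SimpleGraph.mem_neighborFinset]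
  simp only [collinearityGraph, Finset.mem_biUnion, Finset.mem_erase,
    SimpleGraph.mem_neighborFinset, G.adj_comm w]
  exact ⟨fun ⟨hne, ℓ, hv, hw⟩ => ⟨ℓ, hv, hne.symm, hw⟩,
    fun ⟨ℓ, hv, hne, hw⟩ => ⟨hne.symm, ℓ, hv, hw⟩⟩

namespace ExpandsOn

theorem isRootGram (h : ExpandsOn G B) (hd : G.maxDegree ≤ 3) :
    IsRootGram (G.adjMatrix ℝ ^ 2 - 1) (collinearityGraph G) {v | walkBall G 4 v ⊆ B} where
  isSymm := isSymm_adjMatrix_sq_sub_one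
  posDefOn := PosDefOn.mono h fun v hv => hv (walkBall.self_mem _ v)
  apply_self v hv := by
    rw [adjMatrix_sq_sub_one_apply_self, h.degree_eq_three hd hv]
    norm_num
  apply_of_adj u hu v hv := fun ⟨huv, _, huℓ, hvℓ⟩ =>
    h.apply_eq_one hd (hu (walkBall.self_mem _ u)) (hv (walkBall.self_mem _ v)) huv huℓ hvℓ
  apply_of_not_adj u _ v _ huv hnot :=
    adjMatrix_sq_sub_one_apply_eq_zero huv fun ℓ huℓ hvℓ => hnot ⟨huv, ℓ, huℓ, hvℓ⟩

theorem degree_collinearityGraph (h : ExpandsOn G B) (hd : G.maxDegree ≤ 3)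
    (hv : walkBall G 5 v ⊆ B) : (collinearityGraph G).degree v = 6 := by
  have hdisj : (G.neighborFinset v : Set V).PairwiseDisjoint
      fun ℓ => (G.neighborFinset ℓ).erase v := by
    refine fun ℓ hℓ ℓ' hℓ' hne => Finset.disjoint_left.mpr fun w hw hw' => hne ?_
    simp only [Finset.mem_coe, Finset.mem_erase, SimpleGraph.mem_neighborFinset] at hℓ hℓ' hw hw'
    exact h.eq_of_common_neighbors hd (hv (walkBall.self_mem _ v))
      (walkBall.subset_of_adj_of_adj hv hℓ hw.2.symm (walkBall.self_mem _ w)) hw.1.symm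
      hℓ hw.2.symm hℓ' hw'.2.symm
  have hline (ℓ : V) (hℓ : ℓ ∈ G.neighborFinset v) : ((G.neighborFinset ℓ).erase v).card = 2 := by
    rw [SimpleGraph.mem_neighborFinset] at hℓ
    rw [Finset.card_erase_of_mem (by simpa using hℓ.symm),
      SimpleGraph.card_neighborFinset_eq_degree,
      h.degree_eq_three hd (walkBall.subset_of_adj hv hℓ)]
  rw [← SimpleGraph.card_neighborFinset_eq_degree, neighborFinset_collinearityGraph,
    Finset.card_biUnion hdisj, Finset.sum_congr rfl hline, Finset.sum_const,
    SimpleGraph.card_neighborFinset_eq_degree,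
    h.degree_eq_three hd ((walkBall.mono (by norm_num) v).trans hv), smul_eq_mul]

theorem eq_of_neighborFinset_eq_triple (h : ExpandsOn G B) (hd : G.maxDegree ≤ 3)
    {x y z ℓ ℓ' : V} (hv : v ∈ B) (hy : y ∈ B) (hvy : v ≠ y) (hzv : z ≠ v) (hzy : z ≠ y)
    (hℓ : G.neighborFinset ℓ = {v, x, y}) (hℓ' : G.neighborFinset ℓ' = {v, y, z}) : z = x := by
  have hmem {w : V} : w ∈ ({v, x, y} : Finset V) ↔ G.Adj w ℓ := by
    rw [← hℓ, SimpleGraph.mem_neighborFinset, G.adj_comm]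
  have hmem' {w : V} : w ∈ ({v, y, z} : Finset V) ↔ G.Adj w ℓ' := by
    rw [← hℓ', SimpleGraph.mem_neighborFinset, G.adj_comm]
  obtain rfl := h.eq_of_common_neighbors hd hv hy hvy (hmem.mp (by simp)) (hmem.mp (by simp))
    (hmem'.mp (by simp)) (hmem'.mp (by simp))
  have hz : z ∈ ({v, x, y} : Finset V) := hmem.mpr (hmem'.mp (by simp))
  simpa [hzv, hzy] using hz

theorem isInteriorPoint (h : ExpandsOn G B) (hd : G.maxDegree ≤ 3) (hv : walkBall G 6 v ⊆ B) :
    IsInteriorPoint (collinearityGraph G) {v | walkBall G 4 v ⊆ B} v where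
  mem := (walkBall.mono (by norm_num) v).trans hv
  neighborSet_subset := fun _ ⟨_, _, hvℓ, hyℓ⟩ => walkBall.subset_of_adj_of_adj hv hvℓ hyℓ
  degree_eq := h.degree_collinearityGraph hd ((walkBall.mono (by norm_num) v).trans hv)
  exists_pairing := by
    have hthird (y : V) : ∃ y', (collinearityGraph G).Adj v y →
        y' ≠ v ∧ y' ≠ y ∧ ∃ ℓ, G.neighborFinset ℓ = {v, y, y'} := by
      by_cases hy : (collinearityGraph G).Adj v y
      · obtain ⟨hvy, ℓ, hvℓ, hyℓ⟩ := hy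
        have hℓ := h.degree_eq_three hd
          ((walkBall.mono (by norm_num) ℓ).trans (walkBall.subset_of_adj hv hvℓ))
        obtain ⟨y', hy'v, hy'y, hN⟩ := exists_neighborFinset_eq_triple hℓ hvℓ hyℓ hvy
        exact ⟨y', fun _ => ⟨hy'v, hy'y, ℓ, hN⟩⟩
      · exact ⟨v, fun h => absurd h hy⟩
    choose σ hσ using hthird
    refine ⟨σ, fun y hy => ?_⟩
    obtain ⟨hne, hne', ℓ, hℓ⟩ := hσ y hy
    have hmem {w : V} (hw : w ∈ ({v, y, σ y} : Finset V)) : G.Adj w ℓ := by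
      rwa [← hℓ, SimpleGraph.mem_neighborFinset, G.adj_comm] at hw
    have hvℓ : G.Adj v ℓ := hmem (by simp)
    have hσℓ : G.Adj (σ y) ℓ := hmem (by simp)
    have hvσ : (collinearityGraph G).Adj v (σ y) := ⟨hne.symm, ℓ, hvℓ, hσℓ⟩
    obtain ⟨hτ, hτ', ℓ', hℓ'⟩ := hσ (σ y) hvσ
    exact ⟨hvσ, ⟨hne'.symm, ℓ, hmem (by simp), hσℓ⟩,
      h.eq_of_neighborFinset_eq_triple hd (hv (walkBall.self_mem _ v))
        (walkBall.subset_of_adj_of_adj hv hvℓ hσℓ (walkBall.self_mem _ _)) hne.symm hτ hτ' hℓ hℓ'⟩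

theorem not_isDiamond (h : ExpandsOn G B) (hd : G.maxDegree ≤ 3) {p q z w : V}
    (hB : ∀ y ∈ Set.range ![p, q, z, w], walkBall G 6 y ⊆ B) :
    ¬IsDiamond (collinearityGraph G) p q z w :=
  (h.isRootGram hd).not_isDiamond fun y hy => h.isInteriorPoint hd (hB y hy)

end ExpandsOn

end Collinearity

section Hub

namespace IsRootGram

variable {V : Type*} [Fintype V] [DecidableEq V] {M : Matrix V V ℝ} {H : SimpleGraph V}
  [DecidableRel H.Adj] {B : Set V} {u z : V}

theorem sum_neighborFinset_apply (h : IsRootGram M H B) (hz : H.neighborSet z ⊆ B)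
    (hu : H.Adj z u) :
    ∑ v ∈ H.neighborFinset z, M u v = 2 + (H.neighborFinset z ∩ H.neighborFinset u).card := by
  have huz : u ∈ H.neighborFinset z := by simpa using hu
  have hrest : ∀ v ∈ (H.neighborFinset z).erase u, M u v = if H.Adj u v then 1 else 0 := by
    intro v hv
    rw [Finset.mem_erase, SimpleGraph.mem_neighborFinset] at hv
    exact_mod_cast h.apply_eq_ite_adj (hz hu) (hz hv.2) hv.1.symm
  rw [← Finset.add_sum_erase _ _ huz, h.apply_self u (hz hu), Finset.sum_congr rfl hrest,
    Finset.sum_boole]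
  congr 3
  ext v
  simp only [Finset.mem_filter, Finset.mem_erase, Finset.mem_inter, SimpleGraph.mem_neighborFinset]
  exact ⟨fun hv => ⟨hv.1.2, hv.2⟩, fun hv => ⟨⟨hv.2.ne', hv.1⟩, hv.2⟩⟩

-- If every neighbor of `z` had at most one common neighbor with `z`, then the form would be
-- nonpositive on three times `z` minus the sum of its six neighbors.
theorem exists_one_lt_card_inter_neighborFinset (h : IsRootGram M H B)
    (hz : IsInteriorPoint H B z) :
    ∃ u, H.Adj z u ∧ 1 < (H.neighborFinset z ∩ H.neighborFinset u).card := by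
  by_contra! hle
  have hadj (u : H.neighborFinset z) : H.Adj z u := (H.mem_neighborFinset z u).mp u.2
  have hmem (u : H.neighborFinset z) : (u : V) ∈ B := hz.neighborSet_subset (hadj u)
  have hform := h.posDefOn.sum_pos (fun o : Option (H.neighborFinset z) => o.elim z (↑))
    (fun o => o.elim 3 fun _ => -1) (Option.forall.mpr ⟨hz.mem, hmem⟩) (i₀ := none) (by simp)
    (Option.forall.mpr ⟨fun _ => rfl, fun u hu => absurd hu (hadj u).ne'⟩)
  have hrow (u : H.neighborFinset z) : ∑ v : H.neighborFinset z, M u v ≤ 3 := by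
    rw [Finset.sum_coe_sort (H.neighborFinset z) (M u),
      h.sum_neighborFinset_apply hz.neighborSet_subset (hadj u)]
    have hone : ((H.neighborFinset z ∩ H.neighborFinset u).card : ℝ) ≤ 1 := by
      exact_mod_cast hle u (hadj u)
    linarith
  have hsum : ∑ u : H.neighborFinset z, ∑ v : H.neighborFinset z, M u v ≤ 18 :=
    (Finset.sum_le_card_nsmul _ _ 3 fun u _ => hrow u).trans_eq
      (by simp [hz.degree_eq]; norm_num)
  have hz_row (u : H.neighborFinset z) : M z u = 1 := h.apply_of_adj z hz.mem u (hmem u) (hadj u)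
  have hz_col (u : H.neighborFinset z) : M u z = 1 := by rw [← h.isSymm.apply, hz_row]
  simp only [Fintype.sum_option, Option.elim, h.apply_self z hz.mem, hz_row, hz_col,
    Finset.sum_add_distrib, ← Finset.mul_sum, Finset.sum_const, Finset.card_univ,
    Fintype.card_coe, SimpleGraph.card_neighborFinset_eq_degree, hz.degree_eq, nsmul_eq_mul,
    Nat.cast_ofNat] at hform
  linarith

end IsRootGram

end Hub

/-- The labeling `P` of seven vertices of `G` by the points of the Fano plane sends the points of
the Fano line `l` to collinear points, where the lines are neighborhoods of vertices of `G`. -/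
def IsFanoLine {V : Type*} (G : SimpleGraph V) (P : ZMod 7 → V) (l : ZMod 7) : Prop :=
  ∃ ℓ, ∀ p, FanoIncident p l → G.Adj (P p) ℓ

theorem card_filter_fanoIncident_line (l : ZMod 7) :
    (Finset.univ.filter fun p => FanoIncident p l).card = 3 := by
  revert l
  decide

theorem card_filter_fanoIncident_point (p : ZMod 7) :
    (Finset.univ.filter fun l => FanoIncident p l).card = 3 := by
  revert p
  decide

theorem exists_fanoIncident_ne (l x : ZMod 7) : ∃ q, FanoIncident q l ∧ q ≠ x := by
  revert l x
  decide

theorem eq_of_fanoIncident {p q l m : ZMod 7} (hpq : p ≠ q) (hpl : FanoIncident p l)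
    (hql : FanoIncident q l) (hpm : FanoIncident p m) (hqm : FanoIncident q m) : l = m :=
  (fano_existsUnique_line p q hpq).unique ⟨hpl, hql⟩ ⟨hpm, hqm⟩

theorem heawoodGraph_reachable (b : ZMod 7 ⊕ ZMod 7) :
    heawoodGraph.Reachable (Sum.inl 0) b := by
  have hpoint (q : ZMod 7) : heawoodGraph.Reachable (Sum.inl 0) (Sum.inl q) := by
    by_cases hq : q = 0
    · rw [hq]
    · obtain ⟨l, ⟨h₀, hl⟩, -⟩ := fano_existsUnique_line 0 q (Ne.symm hq)
      have h₀l : heawoodGraph.Adj (Sum.inl 0) (Sum.inr l) := h₀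
      have hlq : heawoodGraph.Adj (Sum.inr l) (Sum.inl q) := hl
      exact h₀l.reachable.trans hlq.reachable
  rcases b with q | l
  · exact hpoint q
  · have hl : heawoodGraph.Adj (Sum.inl l) (Sum.inr l) := Or.inl rfl
    exact (hpoint l).trans hl.reachable

section Fano

variable {V : Type*} [Fintype V] {G : SimpleGraph V} [DecidableRel G.Adj] {P : ZMod 7 → V}

theorem exists_eq_of_card_eq_three (hd : G.maxDegree ≤ 3) {ι : Type*} {f : ι → V}
    (hf : Function.Injective f) {s : Finset ι} (hs : s.card = 3) {v w : V}
    (hv : ∀ i ∈ s, G.Adj v (f i)) (hvw : G.Adj v w) : ∃ i ∈ s, f i = w := by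
  have hsub : s.map ⟨f, hf⟩ ⊆ G.neighborFinset v := by
    intro u hu
    obtain ⟨i, hi, rfl⟩ := Finset.mem_map.mp hu
    exact (G.mem_neighborFinset v _).mpr (hv i hi)
  have hcard : (G.neighborFinset v).card ≤ (s.map ⟨f, hf⟩).card := by
    rw [Finset.card_map, hs]
    exact (G.degree_le_maxDegree v).trans hd
  have hw : w ∈ s.map ⟨f, hf⟩ := by
    rwa [Finset.eq_of_subset_of_card_le hsub hcard, SimpleGraph.mem_neighborFinset]
  exact Finset.mem_map.mp hw

theorem adj_iff_fanoIncident (hd : G.maxDegree ≤ 3) (hP : Function.Injective P) {l : ZMod 7}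
    {ℓ : V} (hℓ : ∀ p, FanoIncident p l → G.Adj (P p) ℓ) (q : ZMod 7) :
    G.Adj (P q) ℓ ↔ FanoIncident q l := by
  refine ⟨fun hq => ?_, hℓ q⟩
  obtain ⟨p, hp, hpq⟩ := exists_eq_of_card_eq_three hd hP (card_filter_fanoIncident_line l)
    (fun p hp => (hℓ p (Finset.mem_filter.mp hp).2).symm) hq.symm
  rw [← hP hpq]
  exact (Finset.mem_filter.mp hp).2

-- A point of degree three lies on only one line besides two given ones.
theorem IsFanoLine.of_pencil (hd : G.maxDegree ≤ 3)
    (hP : Pairwise fun p q => (collinearityGraph G).Adj (P p) (P q)) {l₁ l₂ : ZMod 7}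
    (h₁ : IsFanoLine G P l₁) (h₂ : IsFanoLine G P l₂) (hl : l₁ ≠ l₂) {x l : ZMod 7}
    (hx₁ : FanoIncident x l₁) (hx₂ : FanoIncident x l₂) (hx : FanoIncident x l) (hl₁ : l ≠ l₁)
    (hl₂ : l ≠ l₂) : IsFanoLine G P l := by
  classical
  have hinj : Function.Injective P := fun p q hpq => by_contra fun hne => (hP hne).1 hpq
  obtain ⟨ℓ₁, hℓ₁⟩ := h₁
  obtain ⟨ℓ₂, hℓ₂⟩ := h₂
  have hℓ : ℓ₁ ≠ ℓ₂ := by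
    rintro rfl
    obtain ⟨q, hq, hqx⟩ := exists_fanoIncident_ne l₁ x
    exact hl (eq_of_fanoIncident hqx hq hx₁
      ((adj_iff_fanoIncident hd hinj hℓ₂ q).mp (hℓ₁ q hq)) hx₂)
  have hrest (q : ZMod 7) (hq : FanoIncident q l) (hqx : q ≠ x) :
      ∃ k ∈ G.neighborFinset (P x) \ {ℓ₁, ℓ₂}, G.Adj (P q) k := by
    obtain ⟨-, k, hxk, hqk⟩ := hP hqx.symm
    refine ⟨k, ?_, hqk⟩
    rw [Finset.mem_sdiff, SimpleGraph.mem_neighborFinset, Finset.mem_insert,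
      Finset.mem_singleton, not_or]
    refine ⟨hxk, ?_, ?_⟩
    · rintro rfl
      exact hl₁ (eq_of_fanoIncident hqx hq hx ((adj_iff_fanoIncident hd hinj hℓ₁ q).mp hqk) hx₁)
    · rintro rfl
      exact hl₂ (eq_of_fanoIncident hqx hq hx ((adj_iff_fanoIncident hd hinj hℓ₂ q).mp hqk) hx₂)
  have hone : (G.neighborFinset (P x) \ {ℓ₁, ℓ₂}).card ≤ 1 := by
    rw [Finset.card_sdiff_of_subset (by
        simp [Finset.insert_subset_iff, hℓ₁ x hx₁, hℓ₂ x hx₂]), Finset.card_pair hℓ,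
      Nat.sub_le_iff_le_add]
    exact (G.degree_le_maxDegree _).trans hd
  obtain ⟨q, hq, hqx⟩ := exists_fanoIncident_ne l x
  obtain ⟨k, hk, -⟩ := hrest q hq hqx
  refine ⟨k, fun p hp => ?_⟩
  by_cases hpx : p = x
  · rw [hpx]
    exact (G.mem_neighborFinset _ _).mp (Finset.mem_sdiff.mp hk).1
  · obtain ⟨k', hk', hpk'⟩ := hrest p hp hpx
    rwa [Finset.card_le_one.mp hone k hk k' hk']

theorem IsFanoLine.forall_of_transversal (hd : G.maxDegree ≤ 3)
    (hP : Pairwise fun p q => (collinearityGraph G).Adj (P p) (P q)) (h₀ : IsFanoLine G P 0)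
    (h₁ : IsFanoLine G P 1) (h₄ : IsFanoLine G P 4) (h₆ : IsFanoLine G P 6) (l : ZMod 7) :
    IsFanoLine G P l := by
  have h₂ : IsFanoLine G P 2 := .of_pencil hd hP h₁ h₆ (x := 2) (by decide) (by decide) (by decide)
    (by decide) (by decide) (by decide)
  have h₃ : IsFanoLine G P 3 := .of_pencil hd hP h₁ h₄ (x := 4) (by decide) (by decide) (by decide)
    (by decide) (by decide) (by decide)
  have h₅ : IsFanoLine G P 5 := .of_pencil hd hP h₀ h₁ (x := 1) (by decide) (by decide) (by decide)
    (by decide) (by decide) (by decide)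
  fin_cases l
  exacts [h₀, h₁, h₂, h₃, h₄, h₅, h₆]

end Fano

section Heawood

variable {V : Type*} {G : SimpleGraph V}

theorem exists_component_iso_heawoodGraph (f : heawoodGraph →g G) (hf : Function.Injective f)
    (hclosed : ∀ a w, G.Adj (f a) w → ∃ b, heawoodGraph.Adj a b ∧ f b = w) :
    ∃ C : G.ConnectedComponent, Nonempty (C.toSimpleGraph ≃g heawoodGraph) := by
  have hrange {u w : V} (p : G.Walk u w) : (∃ a, f a = u) → ∃ b, f b = w := by
    induction p with
    | nil => exact id
    | cons h _ ih =>
      rintro ⟨a, rfl⟩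
      obtain ⟨b, -, hb⟩ := hclosed a _ h
      exact ih ⟨b, hb⟩
  have hmem (b) : f b ∈ G.connectedComponentMk (f (Sum.inl 0)) :=
    SimpleGraph.ConnectedComponent.sound ((heawoodGraph_reachable b).map f).symm
  refine ⟨G.connectedComponentMk (f (Sum.inl 0)), ⟨SimpleGraph.Iso.symm
    ⟨Equiv.ofBijective (fun b => ⟨f b, hmem b⟩) ⟨?_, ?_⟩, ?_⟩⟩⟩
  · exact fun a b hab => hf (congrArg Subtype.val hab)
  · rintro ⟨w, hw⟩
    obtain ⟨p⟩ := (SimpleGraph.ConnectedComponent.exact hw).symm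
    obtain ⟨b, rfl⟩ := hrange p ⟨_, rfl⟩
    exact ⟨b, rfl⟩
  · intro a b
    change G.Adj (f a) (f b) ↔ heawoodGraph.Adj a b
    refine ⟨fun h => ?_, f.map_rel⟩
    obtain ⟨c, hc, hbc⟩ := hclosed a _ h
    rwa [← hf hbc]

theorem exists_component_iso_heawoodGraph_of_isFanoLine [Fintype V] [DecidableRel G.Adj]
    (hG : G.IsBipartite) (hd : G.maxDegree ≤ 3) {P : ZMod 7 → V} (hP : Function.Injective P)
    (hlines : ∀ l, IsFanoLine G P l) :
    ∃ C : G.ConnectedComponent, Nonempty (C.toSimpleGraph ≃g heawoodGraph) := by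
  choose L hL using hlines
  have hadj (p l) : G.Adj (P p) (L l) ↔ FanoIncident p l := adj_iff_fanoIncident hd hP (hL l) p
  have hL_inj : Function.Injective L := by
    intro l m hlm
    obtain ⟨q, hq, hql⟩ := exists_fanoIncident_ne l l
    have hinc (p) : FanoIncident p l → FanoIncident p m := by rw [← hadj, ← hadj, hlm]; exact id
    exact eq_of_fanoIncident hql hq (Or.inl rfl) (hinc q hq) (hinc l (Or.inl rfl))
  have hPL (p l) : P p ≠ L l := by
    intro hpl
    obtain ⟨c⟩ := hG
    obtain ⟨q, hq, hqp⟩ := exists_fanoIncident_ne l p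
    obtain ⟨k, ⟨hpk, hqk⟩, -⟩ := fano_existsUnique_line p q hqp.symm
    have hqp_color := c.valid (hL l q hq)
    have hpk_color := c.valid (hL k p hpk)
    have hqk_color := c.valid (hL k q hqk)
    rw [← hpl] at hqp_color
    omega
  let f : heawoodGraph →g G := ⟨Sum.elim P L, by
    rintro (p | l) (q | m) h
    exacts [h.elim, (hadj p m).mpr h, ((hadj q l).mpr h).symm, h.elim]⟩
  refine exists_component_iso_heawoodGraph f (hP.sumElim hL_inj hPL) ?_
  rintro (p | l) w hw
  · obtain ⟨m, hm, rfl⟩ := exists_eq_of_card_eq_three hd hL_inj (card_filter_fanoIncident_point p)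
      (fun m hm => (hadj p m).mpr (Finset.mem_filter.mp hm).2) hw
    exact ⟨Sum.inr m, (Finset.mem_filter.mp hm).2, rfl⟩
  · obtain ⟨q, hq, rfl⟩ := exists_eq_of_card_eq_three hd hP (card_filter_fanoIncident_line l)
      (fun q hq => ((hadj q l).mpr (Finset.mem_filter.mp hq).2).symm) hw
    exact ⟨Sum.inl q, (Finset.mem_filter.mp hq).2, rfl⟩

end Heawood

/-- Three lines `ℓ i` through the point `z`, and a line `m` that does not contain `z` and meets
`ℓ i` in the point `p i`, where points and lines are vertices of `G` and incidence is adjacency. -/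
structure IsTransversal {V : Type*} (G : SimpleGraph V) (z : V) (ℓ p : Fin 3 → V) (m : V) :
    Prop where
  adj_vertex : ∀ i, G.Adj z (ℓ i)
  adj_line : ∀ i, G.Adj (p i) (ℓ i)
  adj_transversal : ∀ i, G.Adj (p i) m
  injective : Function.Injective p
  not_adj : ¬G.Adj z m

theorem IsTransversal.vertex_ne {V : Type*} {G : SimpleGraph V} {z : V} {ℓ p : Fin 3 → V} {m : V}
    (hT : IsTransversal G z ℓ p m) (i : Fin 3) : z ≠ p i :=
  fun hz => hT.not_adj (hz ▸ hT.adj_transversal i)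

/-- The labeling by the points of the Fano plane of a vertex `z` (label `0`) and of further points
`p i` and `q i` on three lines through `z`. With these labels the three lines are the Fano lines
`0`, `4`, `6`, and `p 0`, `p 1`, `p 2` form the Fano line `1`. -/
def pencilLabeling {V : Type*} (z : V) (p q : Fin 3 → V) : ZMod 7 → V :=
  ![z, p 0, p 2, q 0, p 1, q 1, q 2]

theorem pairwise_pencilLabeling {V : Type*} {H : SimpleGraph V} {z : V} {p q : Fin 3 → V}
    (hp : ∀ i, H.Adj z (p i)) (hq : ∀ i, H.Adj z (q i))
    (hpp : Pairwise fun i j => H.Adj (p i) (p j)) (hpq : ∀ i j, H.Adj (p i) (q j))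
    (hqq : Pairwise fun i j => H.Adj (q i) (q j)) :
    Pairwise fun x y => H.Adj (pencilLabeling z p q x) (pencilLabeling z p q y) := by
  intro x y hxy
  fin_cases x <;> fin_cases y <;>
    first
    | exact absurd rfl hxy
    | exact hp _
    | exact (hp _).symm
    | exact hq _
    | exact (hq _).symm
    | exact hpq _ _
    | exact (hpq _ _).symm
    | exact hpp (by decide)
    | exact hqq (by decide)

theorem IsTransversal.isFanoLine_pencilLabeling {V : Type*} {G : SimpleGraph V} {z : V}
    {ℓ p q : Fin 3 → V} {m : V} (hT : IsTransversal G z ℓ p m) (hq : ∀ i, G.Adj (q i) (ℓ i)) :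
    IsFanoLine G (pencilLabeling z p q) 0 ∧ IsFanoLine G (pencilLabeling z p q) 1 ∧
      IsFanoLine G (pencilLabeling z p q) 4 ∧ IsFanoLine G (pencilLabeling z p q) 6 := by
  refine ⟨⟨ℓ 0, ?_⟩, ⟨m, ?_⟩, ⟨ℓ 1, ?_⟩, ⟨ℓ 2, ?_⟩⟩ <;> rintro _ (rfl | rfl | rfl)
  exacts [hT.adj_vertex 0, hT.adj_line 0, hq 0, hT.adj_transversal 0, hT.adj_transversal 2,
    hT.adj_transversal 1, hT.adj_line 1, hq 1, hT.adj_vertex 1, hq 2, hT.adj_vertex 2,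
    hT.adj_line 2]

section Configuration

variable {V : Type*} [Fintype V] [DecidableEq V] {G : SimpleGraph V} [DecidableRel G.Adj]
  {B : Set V} {z : V}

namespace ExpandsOn

theorem exists_triangle (h : ExpandsOn G B) (hd : G.maxDegree ≤ 3) (hz : walkBall G 6 z ⊆ B) :
    ∃ a b ℓ, a ≠ z ∧ G.Adj z ℓ ∧ G.Adj a ℓ ∧ ¬G.Adj b ℓ ∧ (collinearityGraph G).Adj z b ∧
      (collinearityGraph G).Adj a b := by
  obtain ⟨a, ⟨hza, ℓ, hzℓ, haℓ⟩, hcard⟩ :=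
    (h.isRootGram hd).exists_one_lt_card_inter_neighborFinset (h.isInteriorPoint hd hz)
  have hℓ := h.degree_eq_three hd
    ((walkBall.mono (by norm_num) ℓ).trans (walkBall.subset_of_adj hz hzℓ))
  obtain ⟨a', -, -, hN⟩ := exists_neighborFinset_eq_triple hℓ hzℓ haℓ hza
  obtain ⟨b, hb, hba'⟩ := Finset.exists_mem_ne hcard a'
  rw [Finset.mem_inter, SimpleGraph.mem_neighborFinset, SimpleGraph.mem_neighborFinset] at hb
  refine ⟨a, b, ℓ, hza.symm, hzℓ, haℓ, ?_, hb.1, hb.2⟩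
  rw [G.adj_comm, ← SimpleGraph.mem_neighborFinset, hN]
  simp [hb.1.ne', hb.2.ne', hba']

theorem exists_third_neighbor (h : ExpandsOn G B) (hd : G.maxDegree ≤ 3) {u v ℓ : V}
    (hℓ : walkBall G 4 ℓ ⊆ B) (hu : G.Adj u ℓ) (hv : G.Adj v ℓ) (huv : u ≠ v) :
    ∃ w, w ≠ u ∧ w ≠ v ∧ G.Adj w ℓ := by
  obtain ⟨w, hwu, hwv, hN⟩ :=
    exists_neighborFinset_eq_triple (h.degree_eq_three hd hℓ) hu hv huv
  refine ⟨w, hwu, hwv, ?_⟩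
  rw [G.adj_comm, ← SimpleGraph.mem_neighborFinset, hN]
  simp

theorem collinearityGraph_adj_of_adj (h : ExpandsOn G B) (hd : G.maxDegree ≤ 3)
    (hz : walkBall G 8 z ⊆ B) {p q w : V} (hp : (collinearityGraph G).Adj z p)
    (hq : (collinearityGraph G).Adj z q) (hw : (collinearityGraph G).Adj z w)
    (hpw : (collinearityGraph G).Adj w p) (hqw : (collinearityGraph G).Adj w q) (hpq : p ≠ q) :
    (collinearityGraph G).Adj p q := by
  by_contra hnot
  have hball {y : V} : (collinearityGraph G).Adj z y → walkBall G 6 y ⊆ B :=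
    fun ⟨_, _, hzℓ, hyℓ⟩ => walkBall.subset_of_adj_of_adj hz hzℓ hyℓ
  refine h.not_isDiamond hd ?_ ⟨hpq, hnot, hw, hp.symm, hpw.symm, hq.symm, hqw.symm⟩
  simp [hball hp, hball hq, hball hw, (walkBall.mono (by norm_num : 6 ≤ 8) z).trans hz]

theorem exists_isTransversal (h : ExpandsOn G B) (hd : G.maxDegree ≤ 3)
    (hz : walkBall G 10 z ⊆ B) : ∃ ℓ p m, IsTransversal G z ℓ p m := by
  obtain ⟨a, b, ℓa, haz, hza, ha, hba, ⟨hzb, ℓb, hzℓb, hb⟩, ⟨hab, m, ham, hbm⟩⟩ :=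
    h.exists_triangle hd ((walkBall.mono (by norm_num) z).trans hz)
  have hball_a : walkBall G 8 a ⊆ B := walkBall.subset_of_adj_of_adj hz hza ha
  have hball_m : walkBall G 7 m ⊆ B := walkBall.subset_of_adj hball_a ham
  have hzB : z ∈ B := hz (walkBall.self_mem _ z)
  have haB : a ∈ B := hball_a (walkBall.self_mem _ a)
  have hzm : ¬G.Adj z m := fun hzm =>
    hba (h.eq_of_common_neighbors hd haB hzB haz ham hzm ha hza ▸ hbm)
  obtain ⟨c, hca, hcb, hcm⟩ :=
    h.exists_third_neighbor hd ((walkBall.mono (by norm_num) m).trans hball_m) ham hbm hab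
  have hzc : z ≠ c := fun hzc => hzm (hzc ▸ hcm)
  obtain ⟨-, ℓc, hzℓc, hc⟩ := h.collinearityGraph_adj_of_adj hd hball_a ⟨haz, ℓa, ha, hza⟩
    ⟨hca.symm, m, ham, hcm⟩ ⟨hab, m, ham, hbm⟩ ⟨hzb.symm, ℓb, hb, hzℓb⟩ ⟨hcb.symm, m, hbm, hcm⟩ hzc
  refine ⟨![ℓa, ℓb, ℓc], ![a, b, c], m, ?_, ?_, ?_, ?_, hzm⟩
  · simp [Fin.forall_fin_succ, hza, hzℓb, hzℓc]
  · simp [Fin.forall_fin_succ, ha, hb, hc]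
  · simp [Fin.forall_fin_succ, ham, hbm, hcm]
  · simp [← List.nodup_ofFn, hab, hca.symm, hcb.symm]

theorem injective_of_isTransversal (h : ExpandsOn G B) (hd : G.maxDegree ≤ 3) {ℓ p : Fin 3 → V}
    {m : V} (hT : IsTransversal G z ℓ p m) (hp : ∀ i, p i ∈ B) : Function.Injective ℓ := by
  intro i j hij
  by_contra hne
  have hℓm : ℓ i = m := h.eq_of_common_neighbors hd (hp i) (hp j) (hT.injective.ne hne)
    (hT.adj_line i) (hij ▸ hT.adj_line j) (hT.adj_transversal i) (hT.adj_transversal j)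
  exact hT.not_adj (hℓm ▸ hT.adj_vertex i)

theorem exists_pencilLabeling_of_isTransversal (h : ExpandsOn G B) (hd : G.maxDegree ≤ 3)
    (hz : walkBall G 10 z ⊆ B) {ℓ p : Fin 3 → V} {m : V} (hT : IsTransversal G z ℓ p m) :
    ∃ q : Fin 3 → V, (∀ i, G.Adj (q i) (ℓ i)) ∧ Pairwise fun x y =>
      (collinearityGraph G).Adj (pencilLabeling z p q x) (pencilLabeling z p q y) := by
  have hball_line (i : Fin 3) : walkBall G 4 (ℓ i) ⊆ B :=
    (walkBall.mono (by norm_num) _).trans (walkBall.subset_of_adj hz (hT.adj_vertex i))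
  choose q hqz hqp hq using fun i => h.exists_third_neighbor hd (hball_line i)
    (hT.adj_vertex i) (hT.adj_line i) (hT.vertex_ne i)
  have hball {u : V} {i : Fin 3} (hu : G.Adj u (ℓ i)) : walkBall G 8 u ⊆ B :=
    walkBall.subset_of_adj_of_adj hz (hT.adj_vertex i) hu
  have hB {u : V} {i : Fin 3} (hu : G.Adj u (ℓ i)) : u ∈ B := hball hu (walkBall.self_mem _ u)
  have hℓ := h.injective_of_isTransversal hd hT fun i => hB (hT.adj_line i)
  have hcross {v : V} {i j : Fin 3} (hij : i ≠ j) (hv : G.Adj v (ℓ i)) : v ≠ q j := by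
    rintro rfl
    exact hij (hℓ (h.eq_of_common_neighbors hd (hB hv) (hz (walkBall.self_mem _ z)) (hqz j) hv
      (hT.adj_vertex i) (hq j) (hT.adj_vertex j)))
  have hzp (i : Fin 3) : (collinearityGraph G).Adj z (p i) :=
    ⟨hT.vertex_ne i, ℓ i, hT.adj_vertex i, hT.adj_line i⟩
  have hzq (i : Fin 3) : (collinearityGraph G).Adj z (q i) :=
    ⟨(hqz i).symm, ℓ i, hT.adj_vertex i, hq i⟩
  have hpp : Pairwise fun i j => (collinearityGraph G).Adj (p i) (p j) := fun i j hij =>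
    ⟨hT.injective.ne hij, m, hT.adj_transversal i, hT.adj_transversal j⟩
  have hpq_self (i : Fin 3) : (collinearityGraph G).Adj (p i) (q i) :=
    ⟨(hqp i).symm, ℓ i, hT.adj_line i, hq i⟩
  have hz₈ : walkBall G 8 z ⊆ B := (walkBall.mono (by norm_num) z).trans hz
  have hpq (i j : Fin 3) : (collinearityGraph G).Adj (p i) (q j) := by
    obtain rfl | hij := eq_or_ne i j
    · exact hpq_self i
    · exact h.collinearityGraph_adj_of_adj hd hz₈ (hzp i) (hzq j) (hzp j) (hpp hij.symm)
        (hpq_self j) (hcross hij (hT.adj_line i))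
  have hqq : Pairwise fun i j => (collinearityGraph G).Adj (q i) (q j) := fun i j hij =>
    h.collinearityGraph_adj_of_adj hd hz₈ (hzq i) (hzq j) (hzp i) (hpq i i) (hpq i j)
      (hcross hij (hq i))
  exact ⟨q, hq, pairwise_pencilLabeling hzp hzq hpp hpq hqq⟩

end ExpandsOn

theorem not_expandsOn_walkBall (hG : G.IsBipartite) (hd : G.maxDegree ≤ 3)
    (hH : ∀ C : G.ConnectedComponent, IsEmpty (C.toSimpleGraph ≃g heawoodGraph)) (z : V) :
    ¬ExpandsOn G (walkBall G 10 z) := by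
  intro h
  obtain ⟨ℓ, p, m, hT⟩ := h.exists_isTransversal hd subset_rfl
  obtain ⟨q, hq, hP⟩ := h.exists_pencilLabeling_of_isTransversal hd subset_rfl hT
  obtain ⟨h₀, h₁, h₄, h₆⟩ := hT.isFanoLine_pencilLabeling hq
  have hP_inj : Function.Injective (pencilLabeling z p q) := fun x y hxy =>
    by_contra fun hne => (hP hne).1 hxy
  obtain ⟨C, ⟨e⟩⟩ := exists_component_iso_heawoodGraph_of_isFanoLine hG hd hP_inj
    (IsFanoLine.forall_of_transversal hd hP h₀ h₁ h₄ h₆)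
  exact (hH C).false e

end Configuration

theorem theorem3 :
    ∃ δ : ℝ, 0 < δ ∧
      ∀ (V : Type*) [Fintype V] [DecidableEq V] (G : SimpleGraph V) [DecidableRel G.Adj],
        G.IsBipartite →
        G.maxDegree ≤ 3 →
        (∀ C : G.ConnectedComponent, IsEmpty (C.toSimpleGraph ≃g heawoodGraph)) →
        ∀ i : Fin (Fintype.card V),
          (1 / 2 - δ) * (Fintype.card V : ℝ) ≤ ((i : ℕ) : ℝ) + 1 →
          ((i : ℕ) : ℝ) + 1 ≤ (1 / 2 + δ) * (Fintype.card V : ℝ) →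
          adjEigenvalue G i ∈ Set.Icc (-1 : ℝ) 1 :=
  ⟨1 / 4 ^ (2 * 10 + 4), by positivity, fun _ _ _ _ _ hG hd hH i h₁ h₂ =>
    adjEigenvalue_mem_Icc hG hd (not_expandsOn_walkBall hG hd hH) i h₁ h₂⟩
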